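/- \textbf{Setting.} Let $H(q_1,q_2)=\tfrac12q_2^2-\tfrac12q_1^2+\tfrac14q_1^4$, and consider one of the three regions into which the homoclinic orbits $\{H=0\}$ divide the phase plane (right well $H<0,\ q_1>0$; left well $H<0,\ q_1<0$; outer region $H>0$), without the equilibria. Let $(I,\varphi)$ be the action-angle variables of $\dot q_1=\partial H/\partial q_2,\ \dot q_2=-\partial H/\partial q_1$ in this region given by the Jacobi elliptic functions: $I=\frac1{2\pi}\oint q_2\,dq_1$, $\dot\varphi=\Omega(I)$, $\varphi$ has period $2\pi$, and $\varphi=0$ is the point of the orbit with $q_2=0$ at which $|q_1|$ is largest (and, in the outer region, $q_1>0$). Let $\eta,\alpha,\nu,\sigma\in\mathbb R$, $\delta>0$, let $m,n$ be positive integers, and let $I_r$ be a value of the action in the region with $m\,\Omega(I_r)=n\nu$. Write $\Omega_r=\Omega(I_r)$, $\Omega_r'=\Omega'(I_r)$, $\Omega_r''=\Omega''(I_r)$. With $g_2(u,v,\theta)=\eta u\cos\theta+\alpha\cos\theta-\delta v$ put $$\mathfrak F(I,\varphi,\theta)=\frac{\partial I}{\partial q_2}\,g_2(q_1,q_2,\theta),\qquad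 \mathfrak G(I,\varphi,\theta)=\frac{\partial\varphi}{\partial q_2}\,g_2(q_1,q_2,\theta),$$ evaluated at $q_i=q_i(I,\varphi)$, and $\mathfrak F'=\partial\mathfrak F/\partial I$. Below, $\mathfrak F,\mathfrak F',\mathfrak G,\partial I/\partial q_2$ are evaluated at $I=I_r$, $\varphi=\psi+\frac nm\theta$; $\langle f\rangle=\frac1{2m\pi}\int_0^{2m\pi}f(\theta)\,d\theta$; and $\mathcal A_1(\psi,\theta)=\frac1\nu\int_0^\theta\big(\mathfrak F(I_r,\psi+\tfrac nm s,s)-\langle\mathfrak F(\psi)\rangle\big)ds$. Let $\mathcal H(\psi,h)=\frac12\Omega_r'h^2-\int_0^\psi\langle\mathfrak F(s)\rangle\,ds$, with Hamiltonian system $\dot\psi=\partial\mathcal H/\partial h,\ \dot h=-\partial\mathcal H/\partial\psi$. Let $(\psi_{sd},0)$ be a saddle and $(\psi_{sk},0)$ a center of this system, i.e. $\langle\mathfrak F\rangle$ vanishes at $\psi_{sd}$ and $\psi_{sk}$, with $\Omega_r'\,\partial_\psi\langle\mathfrak F\rangle>0$ at $\psi_{sd}$ and $<0$ at $\psi_{sk}$,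 such that a homoclinic orbit of the saddle encloses the center. \textbf{Statement.} Let $\mathfrak h$ lie strictly between $\mathcal H(\psi_{sk},0)$ and $\mathcal H(\psi_{sd},0)$. Then there is a closed orbit of the Hamiltonian system around $(\psi_{sk},0)$ (that is, one crossing the line $\psi=\psi_{sk}$) with $\mathcal H=\mathfrak h$. For every such orbit $(\psi(t),h(t))$, with least period $\mathfrak T$, let $\mathbb A[f](\mathfrak h)=\frac1{\mathfrak T}\int_0^{\mathfrak T}f(\psi(t),h(t))\,dt$ and $g(\mathfrak h)=\mathbb A[h^2](\mathfrak h)$. Then the averaged coefficients $$\mathfrak B_1=-\Omega_r'\,\mathbb A\Big[\Big\langle\mathcal A_1\mathfrak F+\Omega_r'h^2\frac{\partial\mathcal A_1}{\partial\psi}\Big\rangle\Big],\qquad \mathfrak B_2=\mathbb A\Big[\Big\langle\big(\Omega_r'\mathfrak F'-\tfrac12\Omega_r''\langle\mathfrak F\rangle\big)h^2-\langle\mathfrak F\rangle\mathfrak G\Big\rangle\Big],$$ $$\mathfrak B_\sigma=\tfrac12\sigma^2\Omega_r'\,\mathbb A\Big[\Big\langle\Big(\frac{\partial I}{\partial q_2}\Big)^2\Big\rangle\Big],\qquad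 \Xi=\sigma^2(\Omega_r')^2\,\mathbb A\Big[\Big\langle\Big(h\frac{\partial I}{\partial q_2}\Big)^2\Big\rangle\Big]$$ satisfy $$\mathfrak B_1(\mathfrak h)=0,\qquad \mathfrak B_2(\mathfrak h)=-\delta\,\Omega_r'\,g(\mathfrak h),\qquad \mathfrak B_\sigma(\mathfrak h)=\frac12\sigma^2\frac{\Omega_r'I_r}{\Omega_r},\qquad \Xi(\mathfrak h)=\frac{\sigma^2(\Omega_r')^2I_r}{\Omega_r}\,g(\mathfrak h).$$ -/

import Mathlib

open Filter Topology

noncomputable section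

/-! ## Jacobi elliptic functions (modulus `k`, `0 < k < 1`) -/

/-- Incomplete elliptic integral of the first kind. -/
def ellipticF (k x : ℝ) : ℝ := ∫ s in (0 : ℝ)..x, 1 / √(1 - k ^ 2 * Real.sin s ^ 2)

/-- Complete elliptic integral of the first kind. -/
def ellipticK (k : ℝ) : ℝ := ellipticF k (Real.pi / 2)

/-- Jacobi amplitude: for `0 < k < 1` the map `ellipticF k` is a bijection of `ℝ` and this is
its inverse. -/
def jacobiAm (k u : ℝ) : ℝ := Function.invFun (ellipticF k) u

def jacobiSn (k u : ℝ) : ℝ := Real.sin (jacobiAm k u)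

def jacobiCn (k u : ℝ) : ℝ := Real.cos (jacobiAm k u)

def jacobiDn (k u : ℝ) : ℝ := √(1 - k ^ 2 * jacobiSn k u ^ 2)

/-! ## The unperturbed double-well oscillator and its action-angle variables -/

/-- The Hamiltonian `H(q, p) = p² / 2 - q² / 2 + q⁴ / 4`. -/
def duffingH (q p : ℝ) : ℝ := p ^ 2 / 2 - q ^ 2 / 2 + q ^ 4 / 4

/-- The three regions into which the homoclinic orbits `H = 0` separate the phase plane. -/
inductive DuffingRegion where
  | rightWell
  | leftWell
  | outer

namespace DuffingRegion

/-- The values taken by the modulus `k`, which labels the orbits of the region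
(equilibria and homoclinic orbits are excluded). -/
def moduli : DuffingRegion → Set ℝ
  | rightWell => Set.Ioo 0 1
  | leftWell => Set.Ioo 0 1
  | outer => Set.Ioo (1 / √2) 1

/-- The value of `H` on the orbit with modulus `k`. -/
def energy : DuffingRegion → ℝ → ℝ
  | rightWell, k => -(1 - k ^ 2) / (2 - k ^ 2) ^ 2
  | leftWell, k => -(1 - k ^ 2) / (2 - k ^ 2) ^ 2
  | outer, k => k ^ 2 * (1 - k ^ 2) / (2 * k ^ 2 - 1) ^ 2

/-- The angular frequency on the orbit with modulus `k`. -/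
def freq : DuffingRegion → ℝ → ℝ
  | rightWell, k => 2 * Real.pi / (2 * ellipticK k * √(2 - k ^ 2))
  | leftWell, k => 2 * Real.pi / (2 * ellipticK k * √(2 - k ^ 2))
  | outer, k => 2 * Real.pi / (4 * ellipticK k * √(2 * k ^ 2 - 1))

/-- Position on the orbit with modulus `k`, as a function of the angle `φ` (period `2π`). -/
def orbitQ1 : DuffingRegion → ℝ → ℝ → ℝ
  | rightWell, k, φ => √(2 / (2 - k ^ 2)) * jacobiDn k (2 * ellipticK k / (2 * Real.pi) * φ)
  | leftWell, k, φ => -(√(2 / (2 - k ^ 2)) * jacobiDn k (2 * ellipticK k / (2 * Real.pi) * φ))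
  | outer, k, φ =>
      √(2 * k ^ 2 / (2 * k ^ 2 - 1)) * jacobiCn k (4 * ellipticK k / (2 * Real.pi) * φ)

/-- Velocity on the orbit with modulus `k`, as a function of the angle `φ`. -/
def orbitQ2 : DuffingRegion → ℝ → ℝ → ℝ
  | rightWell, k, φ => -(√2 * k ^ 2 / (2 - k ^ 2)) *
      jacobiCn k (2 * ellipticK k / (2 * Real.pi) * φ) *
      jacobiSn k (2 * ellipticK k / (2 * Real.pi) * φ)
  | leftWell, k, φ => √2 * k ^ 2 / (2 - k ^ 2) *
      jacobiCn k (2 * ellipticK k / (2 * Real.pi) * φ) *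
      jacobiSn k (2 * ellipticK k / (2 * Real.pi) * φ)
  | outer, k, φ => -(√2 * k / (2 * k ^ 2 - 1)) *
      jacobiSn k (4 * ellipticK k / (2 * Real.pi) * φ) *
      jacobiDn k (4 * ellipticK k / (2 * Real.pi) * φ)

/-- The action `(1 / 2π) ∮ q₂ dq₁` of the orbit with modulus `k`. -/
def actionOfModulus (R : DuffingRegion) (k : ℝ) : ℝ :=
  1 / (2 * Real.pi) * ∫ φ in (0 : ℝ)..(2 * Real.pi), R.orbitQ2 k φ * deriv (R.orbitQ1 k) φ

/-- The values taken by the action in the region. -/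
def actions (R : DuffingRegion) : Set ℝ := R.actionOfModulus '' R.moduli

/-- The modulus of the orbit with action `I`. -/
def modulusOfAction (R : DuffingRegion) (I : ℝ) : ℝ :=
  Function.invFunOn R.actionOfModulus R.moduli I

/-- The modulus of the orbit with energy `E`. -/
def modulusOfEnergy (R : DuffingRegion) (E : ℝ) : ℝ :=
  Function.invFunOn R.energy R.moduli E

/-- The frequency `Ω(I)`. -/
def Ω (R : DuffingRegion) (I : ℝ) : ℝ := R.freq (R.modulusOfAction I)

/-- `q₁(I, φ)`. -/
def q1 (R : DuffingRegion) (I φ : ℝ) : ℝ := R.orbitQ1 (R.modulusOfAction I) φ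

/-- `q₂(I, φ)`. -/
def q2 (R : DuffingRegion) (I φ : ℝ) : ℝ := R.orbitQ2 (R.modulusOfAction I) φ

/-- The action `I(q₁, q₂)` of a phase point. -/
def action (R : DuffingRegion) (x y : ℝ) : ℝ :=
  R.actionOfModulus (R.modulusOfEnergy (duffingH x y))

/-- The branch of the angle `φ(q₁, q₂)` with values in `[c - π, c + π)`. For a phase point of
the region the set below has exactly one element. -/
def angle (R : DuffingRegion) (c x y : ℝ) : ℝ :=
  sInf {φ | φ ∈ Set.Ico (c - Real.pi) (c + Real.pi) ∧
    R.q1 (R.action x y) φ = x ∧ R.q2 (R.action x y) φ = y}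

/-- `∂I/∂q₂` at the point `(q₁(I, φ), q₂(I, φ))`. -/
def dActionDq2 (R : DuffingRegion) (I φ : ℝ) : ℝ :=
  deriv (fun y => R.action (R.q1 I φ) y) (R.q2 I φ)

/-- `∂φ/∂q₂` at the point `(q₁(I, φ), q₂(I, φ))`; the derivative of the angle does not depend on
the branch, and the branch centred at `φ` is smooth near that point. -/
def dAngleDq2 (R : DuffingRegion) (I φ : ℝ) : ℝ :=
  deriv (fun y => R.angle φ (R.q1 I φ) y) (R.q2 I φ)

end DuffingRegion

/-! ## The resonance zone -/

/-- The data of an `m : n` resonance of the forced, damped, noisy oscillator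
`q'' = q - q³ + ε (η cos(ν t) q + α cos(ν t) - δ q') + ε^κ σ ξ(t)`
in one of the three regions, `Ir` being the resonant action. -/
structure DuffingResonance where
  region : DuffingRegion
  (η α δ ν σ : ℝ)
  (m n : ℕ)
  Ir : ℝ

namespace DuffingResonance

variable (P : DuffingResonance)

def g2 (u v θ : ℝ) : ℝ := P.η * Real.cos θ * u + P.α * Real.cos θ - P.δ * v

/-- `𝔉(I, φ, θ)`. -/
def F (I φ θ : ℝ) : ℝ :=
  P.region.dActionDq2 I φ * P.g2 (P.region.q1 I φ) (P.region.q2 I φ) θ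

/-- `𝔊(I, φ, θ)`. -/
def G (I φ θ : ℝ) : ℝ :=
  P.region.dAngleDq2 I φ * P.g2 (P.region.q1 I φ) (P.region.q2 I φ) θ

/-- The angle `φ = ψ + (n / m) θ`. -/
def phase (ψ θ : ℝ) : ℝ := ψ + (P.n : ℝ) / P.m * θ

/-- `𝔉'`, the derivative of `𝔉(I, φ, θ)` with respect to `I`. -/
def F' (I φ θ : ℝ) : ℝ := deriv (fun J => P.F J φ θ) I

/-- `Ω_r = Ω(I_r)`. -/
def Ωr : ℝ := P.region.Ω P.Ir

/-- `Ω'_r`. -/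
def Ωr' : ℝ := deriv P.region.Ω P.Ir

/-- `Ω''_r`. -/
def Ωr'' : ℝ := deriv (deriv P.region.Ω) P.Ir

/-- The average `⟨f⟩` over `θ` of a function of period `2 m π`. -/
def thetaAvg (f : ℝ → ℝ) : ℝ :=
  1 / (2 * P.m * Real.pi) * ∫ θ in (0 : ℝ)..(2 * P.m * Real.pi), f θ

/-- `⟨𝔉(ψ)⟩`. -/
def Favg (ψ : ℝ) : ℝ := P.thetaAvg fun θ => P.F P.Ir (P.phase ψ θ) θ

/-- The pendulum Hamiltonian `ℋ(ψ, h) = Ω'_r h² / 2 - ∫₀^ψ ⟨𝔉⟩`. -/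
def pendulumH (ψ h : ℝ) : ℝ := 1 / 2 * P.Ωr' * h ^ 2 - ∫ s in (0 : ℝ)..ψ, P.Favg s

/-- `(ψ(t), h(t))` solves `ψ' = ∂ℋ/∂h`, `h' = -∂ℋ/∂ψ` for all times. -/
def IsPendulumSolution (ψ h : ℝ → ℝ) : Prop :=
  ∀ t, HasDerivAt ψ (deriv (fun y => P.pendulumH (ψ t) y) (h t)) t ∧
    HasDerivAt h (-deriv (fun x => P.pendulumH x (h t)) (ψ t)) t

/-- `(ψsd, 0)` is a saddle and `(ψsk, 0)` a center of the averaged system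
`ψ' = Ω'_r h`, `h' = ⟨𝔉(ψ)⟩`, and the homoclinic orbit of the saddle encloses the center.
Orbits are symmetric about the axis `h = 0`, so that the homoclinic loop encloses
`(ψsk, 0)` exactly when it meets the line `ψ = ψsk`. -/
structure IsSaddleCenterPair (ψsd ψsk : ℝ) : Prop where
  saddle_fixed : P.Favg ψsd = 0
  saddle_type : 0 < P.Ωr' * deriv P.Favg ψsd
  center_fixed : P.Favg ψsk = 0
  center_type : P.Ωr' * deriv P.Favg ψsk < 0
  homoclinic : ∃ ψ h : ℝ → ℝ, P.IsPendulumSolution ψ h ∧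
    Tendsto ψ atTop (𝓝 ψsd) ∧ Tendsto h atTop (𝓝 0) ∧
    Tendsto ψ atBot (𝓝 ψsd) ∧ Tendsto h atBot (𝓝 0) ∧ ∃ t, ψ t = ψsk

/-- `(ψ(t), h(t))` runs through the closed orbit of energy `E` around the center `(ψsk, 0)`, and
`T` is its (least positive) period. -/
structure IsClosedOrbit (ψsk E : ℝ) (ψ h : ℝ → ℝ) (T : ℝ) : Prop where
  solution : P.IsPendulumSolution ψ h
  energy_eq : ∀ t, P.pendulumH (ψ t) (h t) = E
  around_center : ∃ t, ψ t = ψsk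
  period : IsLeast {S : ℝ | 0 < S ∧ Function.Periodic ψ S ∧ Function.Periodic h S} T

end DuffingResonance

/-- The average `𝔸[f]` of a function of `(ψ, h)` over the closed orbit `(ψ(t), h(t))` with
period `T`. -/
def orbitAvg (ψ h : ℝ → ℝ) (T : ℝ) (f : ℝ → ℝ → ℝ) : ℝ :=
  1 / T * ∫ t in (0 : ℝ)..T, f (ψ t) (h t)

namespace DuffingResonance

variable (P : DuffingResonance)

/-- `𝒜₁(ψ, θ)`. -/
def A1 (ψ θ : ℝ) : ℝ :=
  1 / P.ν * ∫ s in (0 : ℝ)..θ, (P.F P.Ir (P.phase ψ s) s - P.Favg ψ)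

/-! The averaged coefficients on a closed orbit `(ψ(t), h(t))` with period `T`. -/

/-- `𝔅₁ = -Ω'_r 𝔸[⟨𝒜₁ 𝔉 + Ω'_r h² ∂𝒜₁/∂ψ⟩]`. -/
def B1 (ψ h : ℝ → ℝ) (T : ℝ) : ℝ :=
  -P.Ωr' * orbitAvg ψ h T fun x y => P.thetaAvg fun θ =>
    P.A1 x θ * P.F P.Ir (P.phase x θ) θ + P.Ωr' * y ^ 2 * deriv (fun z => P.A1 z θ) x

/-- `𝔅₂ = 𝔸[⟨(Ω'_r 𝔉' - ⟨𝔉⟩ Ω''_r / 2) h² - ⟨𝔉⟩ 𝔊⟩]`. -/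
def B2 (ψ h : ℝ → ℝ) (T : ℝ) : ℝ :=
  orbitAvg ψ h T fun x y => P.thetaAvg fun θ =>
    (P.Ωr' * P.F' P.Ir (P.phase x θ) θ - P.Favg x * (1 / 2 * P.Ωr'')) * y ^ 2
      - P.Favg x * P.G P.Ir (P.phase x θ) θ

/-- `𝔅_σ = (σ² / 2) Ω'_r 𝔸[⟨(∂I/∂q₂)²⟩]`. -/
def Bσ (ψ h : ℝ → ℝ) (T : ℝ) : ℝ :=
  1 / 2 * P.σ ^ 2 * P.Ωr' * orbitAvg ψ h T fun x _ => P.thetaAvg fun θ =>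
    P.region.dActionDq2 P.Ir (P.phase x θ) ^ 2

/-- `Ξ = σ² (Ω'_r)² 𝔸[⟨(h ∂I/∂q₂)²⟩]`. -/
def Ξ (ψ h : ℝ → ℝ) (T : ℝ) : ℝ :=
  P.σ ^ 2 * P.Ωr' ^ 2 * orbitAvg ψ h T fun x y => P.thetaAvg fun θ =>
    (y * P.region.dActionDq2 P.Ir (P.phase x θ)) ^ 2

end DuffingResonance

end

/-! ## Calculus of one and two real variables -/

/-! Everything about the unperturbed flow is computed on the explicit orbits `(k, φ) ↦ (q₁, q₂)`,
with `k` the modulus. Along them `∂q₁/∂φ = q₂/ω` and `∂q₂/∂φ = (q₁ - q₁³)/ω`, and differentiating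
`H(q₁, q₂) = energy k` in `k` shows that the Jacobian determinant is, up to sign, `energy'(k)/ω(k)`,
independent of `φ` (`deriv_energy_eq`). This number is also `dI/dk` (`hasDerivAt_actionOfModulus`),
so `(I, φ)` are canonical: `∂I/∂q₂ = q₂/ω` and `∂φ/∂q₂ = -∂q₁/∂I`.

Three facts then give the coefficients. Since `I = (1/2π) ∫ q₂²/ω dφ`, the mean of `(∂I/∂q₂)²` is
`I_r/Ω_r`, which settles `𝔅_σ` and `Ξ`. An area-preserving change of variables preserves divergence,
so `∂𝔉/∂I + ∂𝔊/∂φ = -δ` (`hasDerivAt_G_angle`). Finally, along the averaged flow `⟨𝔉⟩ z(ψ) + Ω'_r h²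
z'(ψ)` is the time derivative of `h z(ψ)` and has mean zero over a closed orbit
(`integral_transport_eq_zero`). With `z = ⟨𝒜₁⟩` and `⟨𝒜₁ 𝔉⟩ = ⟨𝔉⟩⟨𝒜₁⟩` this gives `𝔅₁ = 0`. With `z
= ⟨𝔊⟩`, and `⟨𝔉⟩ h² = (h³/3)'` removing the `Ω''_r` term, it leaves only the damping in `𝔅₂`.

For existence, `⟨𝔉⟩` is `-δ I_r` plus a single harmonic (`exists_Favg_eq`): the averaged system is a
pendulum with constant torque, a particle with velocity `Ω'_r h` in the potential `W = -Ω'_r ∫⟨𝔉⟩`.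
The homoclinic loop projects to a well with the saddle at one end and equal heights at both ends.
The nonzero mean torque makes the well shorter than one period, so the center is the only
equilibrium inside (`eq_center_of_torque_zero`). Hence the turning points at the given energy are
nondegenerate and a periodic motion joins them (`exists_periodic_motion`). -/

theorem continuous_of_continuousOn_strip {U : Set ℝ} {f : ℝ → ℝ → ℝ}
    (hf : ContinuousOn (Function.uncurry f) (U ×ˢ Set.univ)) {k : ℝ} (hk : k ∈ U) :
    Continuous (f k) := by
  have : Continuous fun s : ℝ => ((k, s) : ℝ × ℝ) := by fun_prop
  exact hf.comp_continuous this (fun s => ⟨hk, trivial⟩)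

/-- Differentiation under the integral sign over a compact interval. -/
theorem hasDerivAt_intervalIntegral_of_continuousOn {U : Set ℝ} (hU : IsOpen U)
    {f f' : ℝ → ℝ → ℝ} (hf : ∀ k ∈ U, Continuous (f k))
    (hf' : ContinuousOn (Function.uncurry f') (U ×ˢ Set.univ))
    (hd : ∀ k ∈ U, ∀ s, HasDerivAt (fun κ => f κ s) (f' k s) k) (a b : ℝ) {k : ℝ} (hk : k ∈ U) :
    HasDerivAt (fun κ => ∫ s in a..b, f κ s) (∫ s in a..b, f' k s) k := by
  obtain ⟨r, hr, hrU⟩ := Metric.nhds_basis_closedBall.mem_iff.1 (hU.mem_nhds hk)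
  -- Compactness supplies a constant dominating the parameter derivative, which is integrable on a
  -- bounded interval.
  have hcomp : IsCompact (Metric.closedBall k r ×ˢ Set.uIcc a b) :=
    (isCompact_closedBall k r).prod isCompact_uIcc
  obtain ⟨C, hC⟩ := hcomp.exists_bound_of_continuousOn
    (hf'.mono (Set.prod_mono hrU (Set.subset_univ _)))
  refine (intervalIntegral.hasDerivAt_integral_of_dominated_loc_of_deriv_le
    (F := f) (F' := f') (bound := fun _ => C) (Metric.closedBall_mem_nhds k hr) ?_ ?_ ?_ ?_ ?_ ?_).2
  · filter_upwards [hU.mem_nhds hk] with κ hκ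
    exact (hf κ hκ).aestronglyMeasurable
  · exact (hf k hk).intervalIntegrable _ _
  · exact (continuous_of_continuousOn_strip hf' hk).aestronglyMeasurable
  · refine Filter.Eventually.of_forall fun s hs κ hκ => ?_
    exact hC (κ, s) ⟨hκ, Set.uIoc_subset_uIcc hs⟩
  · exact intervalIntegrable_const
  · exact Filter.Eventually.of_forall fun s _ κ hκ => hd κ (hrU hκ) s

theorem continuousOn_intervalIntegral_strip {U : Set ℝ} {f : ℝ → ℝ → ℝ}
    (hf : ContinuousOn (Function.uncurry f) (U ×ˢ Set.univ)) (a : ℝ) :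
    ContinuousOn (Function.uncurry fun k x => ∫ s in a..x, f k s) (U ×ˢ Set.univ) := by
  have h1 : Continuous (Function.uncurry fun (p : (U ×ˢ (Set.univ : Set ℝ) : Set (ℝ × ℝ)))
      (s : ℝ) => f p.1.1 s) := by
    have : Continuous fun q : (U ×ˢ (Set.univ : Set ℝ) : Set (ℝ × ℝ)) × ℝ =>
        ((q.1.1.1, q.2) : ℝ × ℝ) := by fun_prop
    exact hf.comp_continuous this (fun q => ⟨q.1.2.1, trivial⟩)
  rw [continuousOn_iff_continuous_domRestrict]
  exact intervalIntegral.continuous_parametric_intervalIntegral_of_continuous (a₀ := a) h1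
    (s := fun p => p.1.2) (by fun_prop)

/-- A function of two real variables with continuous partial derivatives is `C¹`. -/
theorem contDiffOn_one_of_partials {S : Set (ℝ × ℝ)} (hS : IsOpen S) {f f₁ f₂ : ℝ → ℝ → ℝ}
    (h₁ : ∀ k x, (k, x) ∈ S → HasDerivAt (fun κ => f κ x) (f₁ k x) k)
    (h₂ : ∀ k x, (k, x) ∈ S → HasDerivAt (f k) (f₂ k x) x)
    (c₁ : ContinuousOn (Function.uncurry f₁) S) (c₂ : ContinuousOn (Function.uncurry f₂) S) :
    ContDiffOn ℝ 1 (Function.uncurry f) S := by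
  let L : ℝ →L[ℝ] ℝ →L[ℝ] ℝ := ContinuousLinearMap.toSpanSingletonCLE.toContinuousLinearMap
  let D : ℝ × ℝ → (ℝ × ℝ →L[ℝ] ℝ) := fun p =>
    (L (f₁ p.1 p.2)).coprod (L (f₂ p.1 p.2))
  have hL : ∀ y : ℝ, L y = ContinuousLinearMap.toSpanSingleton ℝ y := fun _ => rfl
  have hD : ∀ p ∈ S, HasFDerivAt (Function.uncurry f) (D p) p := by
    intro p hp
    have hn := hS.mem_nhds hp
    refine (hasStrictFDerivAt_uncurry_coprod (𝕜 := ℝ) (u := p) (f := f)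
      (f₁ := fun k x => L (f₁ k x)) (f₂ := fun k x => L (f₂ k x))
      ?_ ?_ ?_ ?_).hasFDerivAt
    · filter_upwards [hn] with v hv
      exact (h₁ v.1 v.2 hv).hasFDerivAt
    · filter_upwards [hn] with v hv
      exact (h₂ v.1 v.2 hv).hasFDerivAt
    · exact L.continuous.continuousAt.comp (c₁.continuousAt hn)
    · exact L.continuous.continuousAt.comp (c₂.continuousAt hn)
  rw [show (1 : WithTop ℕ∞) = 0 + 1 by rfl, contDiffOn_succ_iff_fderiv_of_isOpen hS]
  refine ⟨fun p hp => (hD p hp).differentiableAt.differentiableWithinAt, by simp, ?_⟩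
  rw [contDiffOn_zero]
  have hc : ContinuousOn D S := by
    have e : D = fun p => (L (f₁ p.1 p.2)).comp (ContinuousLinearMap.fst ℝ ℝ ℝ)
        + (L (f₂ p.1 p.2)).comp (ContinuousLinearMap.snd ℝ ℝ ℝ) := by
      funext p; ext <;> simp [D]
    rw [e]
    exact ((L.continuous.comp_continuousOn c₁).clm_comp continuousOn_const).add
      ((L.continuous.comp_continuousOn c₂).clm_comp continuousOn_const)
  exact hc.congr fun p hp => (hD p hp).fderiv

/-- On an open set of injectivity `invFunOn` is a local left inverse; strictness of the derivative
is what makes the inverse differentiable. -/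
theorem hasStrictDerivAt_invFunOn {f : ℝ → ℝ} {s : Set ℝ} (hs : IsOpen s) (hinj : Set.InjOn f s)
    {a f' : ℝ} (ha : a ∈ s) (hf : HasStrictDerivAt f f' a) (hf' : f' ≠ 0) :
    HasStrictDerivAt (Function.invFunOn f s) f'⁻¹ (f a) := by
  refine hf.to_local_left_inverse hf' ?_
  filter_upwards [hs.mem_nhds ha] with x hx
  exact hinj.leftInvOn_invFunOn hx

/-- Rolle's theorem: two equal values would force a critical point between them. -/
theorem injOn_of_hasDerivAt_ne_zero {f f' : ℝ → ℝ} {s : Set ℝ} (hs : s.OrdConnected)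
    (hf : ∀ x ∈ s, HasDerivAt f (f' x) x) (hf' : ∀ x ∈ s, f' x ≠ 0) : Set.InjOn f s := by
  have key : ∀ x ∈ s, ∀ y ∈ s, x < y → f x ≠ f y := by
    intro x hx y hy hxy h
    obtain ⟨c, hc, hc'⟩ := exists_hasDerivAt_eq_zero hxy
      (fun z hz => (hf z (hs.out hx hy hz)).continuousAt.continuousWithinAt) h
      (fun z hz => hf z (hs.out hx hy (Set.Ioo_subset_Icc_self hz)))
    exact hf' c (hs.out hx hy (Set.Ioo_subset_Icc_self hc)) hc'
  intro x hx y hy h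
  rcases lt_trichotomy x y with h1 | h1 | h1
  · exact absurd h (key x hx y hy h1)
  · exact h1
  · exact absurd h.symm (key y hy x hx h1)

/-! ## Inverting the integral of a positive function -/

section PositivePrimitive

variable {g : ℝ → ℝ} {c : ℝ}

theorem hasDerivAt_primitive (hg : Continuous g) (x : ℝ) :
    HasDerivAt (fun x => ∫ s in (0 : ℝ)..x, g s) (g x) x :=
  intervalIntegral.integral_hasDerivAt_right (hg.intervalIntegrable _ _)
    hg.aestronglyMeasurable.stronglyMeasurableAtFilter hg.continuousAt

theorem strictMono_primitive (hg : Continuous g) (hc : 0 < c) (hcg : ∀ x, c ≤ g x) :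
    StrictMono fun x => ∫ s in (0 : ℝ)..x, g s :=
  strictMono_of_hasDerivAt_pos (hasDerivAt_primitive hg) fun x => hc.trans_le (hcg x)

theorem surjective_primitive (hg : Continuous g) (hc : 0 < c) (hcg : ∀ x, c ≤ g x) :
    Function.Surjective fun x => ∫ s in (0 : ℝ)..x, g s := by
  -- The primitive grows at least as fast as `c * x`, hence is unbounded in both directions.
  have hmono : Monotone fun x => (∫ s in (0 : ℝ)..x, g s) - c * x := by
    refine monotone_of_hasDerivAt_nonneg (f' := fun x => g x - c)
      (fun x => ?_) fun x => sub_nonneg.2 (hcg x)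
    simpa using (hasDerivAt_primitive hg x).fun_sub ((hasDerivAt_id x).const_mul c)
  have h0 : (∫ s in (0 : ℝ)..0, g s) - c * 0 = 0 := by simp
  refine Continuous.surjective
    (continuous_iff_continuousAt.2 fun x => (hasDerivAt_primitive hg x).continuousAt) ?_ ?_
  · refine tendsto_atTop_mono' _ ?_ (tendsto_id.const_mul_atTop hc)
    filter_upwards [eventually_ge_atTop (0 : ℝ)] with x hx
    have := hmono hx
    simp only [h0] at this
    simpa using this
  · refine tendsto_atBot_mono' _ ?_ (tendsto_id.const_mul_atBot hc)
    filter_upwards [eventually_le_atBot (0 : ℝ)] with x hx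
    have := hmono hx
    simp only [h0] at this
    simpa using this

theorem hasDerivAt_invFun_primitive (hg : Continuous g) (hc : 0 < c) (hcg : ∀ x, c ≤ g x)
    (u : ℝ) :
    HasDerivAt (Function.invFun fun x => ∫ s in (0 : ℝ)..x, g s)
      (g (Function.invFun (fun x => ∫ s in (0 : ℝ)..x, g s) u))⁻¹ u := by
  have hr := Function.rightInverse_invFun (surjective_primitive hg hc hcg)
  set G := fun x => ∫ s in (0 : ℝ)..x, g s
  have hm := strictMono_primitive hg hc hcg
  -- The derivative of an inverse needs its continuity, which comes for free from monotonicity and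
  -- surjectivity.
  have hcont : Continuous (Function.invFun G) := by
    have hmi : StrictMono (Function.invFun G) := fun a b hab => by
      by_contra h
      have : G _ ≤ G _ := hm.monotone (not_lt.1 h)
      rw [hr a, hr b] at this
      exact absurd hab (not_lt.2 this)
    have hsur : Function.Surjective (Function.invFun G) :=
      (Function.leftInverse_invFun hm.injective).surjective
    exact hmi.monotone.continuous_of_surjective hsur
  exact HasDerivAt.of_local_left_inverse hcont.continuousAt (hasDerivAt_primitive hg _)
    (hc.trans_le (hcg _)).ne' (Eventually.of_forall hr)

theorem primitive_add_period (hg : Continuous g) {p : ℝ} (hp : Function.Periodic g p) (x : ℝ) :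
    ∫ s in (0 : ℝ)..(x + p), g s = (∫ s in (0 : ℝ)..x, g s) + ∫ s in (0 : ℝ)..p, g s := by
  have := hp.intervalIntegral_add_eq x 0
  rw [← intervalIntegral.integral_add_adjacent_intervals (hg.intervalIntegrable 0 x)
    (hg.intervalIntegrable x (x + p)), this, zero_add]

theorem invFun_primitive_add_period (hg : Continuous g) (hc : 0 < c) (hcg : ∀ x, c ≤ g x)
    {p : ℝ} (hp : Function.Periodic g p) (u : ℝ) :
    Function.invFun (fun x => ∫ s in (0 : ℝ)..x, g s) (u + ∫ s in (0 : ℝ)..p, g s) =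
      Function.invFun (fun x => ∫ s in (0 : ℝ)..x, g s) u + p := by
  have hr := Function.rightInverse_invFun (surjective_primitive hg hc hcg)
  apply (strictMono_primitive hg hc hcg).injective
  have h1 := hr (u + ∫ s in (0 : ℝ)..p, g s)
  have h2 := hr u
  simp only at h1 h2 ⊢
  rw [h1, primitive_add_period hg hp, h2]

end PositivePrimitive

/-! ## Jacobi elliptic functions -/

section Jacobi

variable {k : ℝ}

theorem one_sub_sq_mul_sin_sq_pos (hk : k ∈ Set.Ioo (0 : ℝ) 1) (x : ℝ) :
    0 < 1 - k ^ 2 * Real.sin x ^ 2 := by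
  have h1 : k ^ 2 < 1 := by nlinarith [hk.1, hk.2]
  nlinarith [Real.sin_sq_le_one x, sq_nonneg k, sq_nonneg (Real.sin x)]

theorem continuous_ellipticF_integrand (hk : k ∈ Set.Ioo (0 : ℝ) 1) :
    Continuous fun s => 1 / √(1 - k ^ 2 * Real.sin s ^ 2) :=
  Continuous.div (by fun_prop) (by fun_prop)
    fun x => (Real.sqrt_pos.2 (one_sub_sq_mul_sin_sq_pos hk x)).ne'

theorem one_le_ellipticF_integrand (hk : k ∈ Set.Ioo (0 : ℝ) 1) (s : ℝ) :
    1 ≤ 1 / √(1 - k ^ 2 * Real.sin s ^ 2) := by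
  rw [le_div_iff₀ (Real.sqrt_pos.2 (one_sub_sq_mul_sin_sq_pos hk s)), one_mul,
    Real.sqrt_le_one]
  nlinarith [mul_nonneg (sq_nonneg k) (sq_nonneg (Real.sin s))]

theorem hasDerivAt_ellipticF (hk : k ∈ Set.Ioo (0 : ℝ) 1) (x : ℝ) :
    HasDerivAt (ellipticF k) (1 / √(1 - k ^ 2 * Real.sin x ^ 2)) x :=
  hasDerivAt_primitive (continuous_ellipticF_integrand hk) x

theorem strictMono_ellipticF (hk : k ∈ Set.Ioo (0 : ℝ) 1) : StrictMono (ellipticF k) :=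
  strictMono_primitive (continuous_ellipticF_integrand hk) one_pos (one_le_ellipticF_integrand hk)

theorem ellipticF_jacobiAm (hk : k ∈ Set.Ioo (0 : ℝ) 1) (u : ℝ) :
    ellipticF k (jacobiAm k u) = u :=
  Function.rightInverse_invFun (surjective_primitive (continuous_ellipticF_integrand hk) one_pos
    (one_le_ellipticF_integrand hk)) u

theorem jacobiAm_ellipticF (hk : k ∈ Set.Ioo (0 : ℝ) 1) (x : ℝ) :
    jacobiAm k (ellipticF k x) = x :=
  Function.leftInverse_invFun (strictMono_ellipticF hk).injective x

theorem ellipticK_pos (hk : k ∈ Set.Ioo (0 : ℝ) 1) : 0 < ellipticK k := by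
  have := strictMono_ellipticF hk Real.pi_div_two_pos
  simpa [ellipticF, ellipticK] using this

theorem hasDerivAt_jacobiAm (hk : k ∈ Set.Ioo (0 : ℝ) 1) (u : ℝ) :
    HasDerivAt (jacobiAm k) (jacobiDn k u) u := by
  have := hasDerivAt_invFun_primitive (continuous_ellipticF_integrand hk) one_pos
    (one_le_ellipticF_integrand hk) u
  rw [one_div, inv_inv] at this
  exact this

theorem jacobiDn_pos (hk : k ∈ Set.Ioo (0 : ℝ) 1) (u : ℝ) : 0 < jacobiDn k u :=
  Real.sqrt_pos.2 (one_sub_sq_mul_sin_sq_pos hk _)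

theorem jacobiDn_sq (hk : k ∈ Set.Ioo (0 : ℝ) 1) (u : ℝ) :
    jacobiDn k u ^ 2 = 1 - k ^ 2 * jacobiSn k u ^ 2 :=
  Real.sq_sqrt (one_sub_sq_mul_sin_sq_pos hk _).le

theorem jacobiSn_sq_add_jacobiCn_sq (k u : ℝ) : jacobiSn k u ^ 2 + jacobiCn k u ^ 2 = 1 :=
  Real.sin_sq_add_cos_sq _

theorem hasDerivAt_jacobiSn (hk : k ∈ Set.Ioo (0 : ℝ) 1) (u : ℝ) :
    HasDerivAt (jacobiSn k) (jacobiCn k u * jacobiDn k u) u :=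
  (hasDerivAt_jacobiAm hk u).sin

theorem hasDerivAt_jacobiCn (hk : k ∈ Set.Ioo (0 : ℝ) 1) (u : ℝ) :
    HasDerivAt (jacobiCn k) (-jacobiSn k u * jacobiDn k u) u :=
  (hasDerivAt_jacobiAm hk u).cos

theorem hasDerivAt_jacobiDn (hk : k ∈ Set.Ioo (0 : ℝ) 1) (u : ℝ) :
    HasDerivAt (jacobiDn k) (-k ^ 2 * jacobiSn k u * jacobiCn k u) u := by
  have h1 : HasDerivAt (fun u => 1 - k ^ 2 * jacobiSn k u ^ 2)
      (-(k ^ 2 * (2 * jacobiSn k u * (jacobiCn k u * jacobiDn k u)))) u := by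
    simpa using (((hasDerivAt_jacobiSn hk u).fun_pow 2).const_mul (k ^ 2)).const_sub 1
  have h2 := h1.sqrt (one_sub_sq_mul_sin_sq_pos hk _).ne'
  refine h2.congr_deriv ?_
  have hd := (jacobiDn_pos hk u).ne'
  change _ / (2 * jacobiDn k u) = _
  field_simp

theorem ellipticF_pi (hk : k ∈ Set.Ioo (0 : ℝ) 1) : ellipticF k Real.pi = 2 * ellipticK k := by
  have hc := continuous_ellipticF_integrand hk
  -- The reflection `s ↦ π - s` leaves the integrand unchanged.
  have h : ∫ s in (Real.pi / 2)..Real.pi, 1 / √(1 - k ^ 2 * Real.sin s ^ 2) = ellipticK k := by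
    have := intervalIntegral.integral_comp_sub_left
      (fun s => 1 / √(1 - k ^ 2 * Real.sin s ^ 2)) (a := Real.pi / 2) (b := Real.pi) Real.pi
    simp only [Real.sin_pi_sub, sub_self, sub_half] at this
    exact this
  rw [ellipticF, ← intervalIntegral.integral_add_adjacent_intervals
    (hc.intervalIntegrable 0 (Real.pi / 2)) (hc.intervalIntegrable _ _), h]
  change ellipticK k + ellipticK k = _
  ring

theorem jacobiAm_add_two_mul_ellipticK (hk : k ∈ Set.Ioo (0 : ℝ) 1) (u : ℝ) :
    jacobiAm k (u + 2 * ellipticK k) = jacobiAm k u + Real.pi := by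
  rw [← ellipticF_pi hk]
  refine invFun_primitive_add_period (continuous_ellipticF_integrand hk) one_pos
    (one_le_ellipticF_integrand hk) (fun x => ?_) u
  simp [Real.sin_add_pi]

theorem jacobiAm_add_int_mul (hk : k ∈ Set.Ioo (0 : ℝ) 1) (u : ℝ) (l : ℤ) :
    jacobiAm k (u + l * (2 * ellipticK k)) = jacobiAm k u + l * Real.pi := by
  induction l with
  | zero => simp
  | succ i ih =>
    push_cast at ih ⊢
    rw [add_mul, one_mul, ← add_assoc, jacobiAm_add_two_mul_ellipticK hk, ih]; ring
  | pred i ih =>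
    have := jacobiAm_add_two_mul_ellipticK hk (u + ((-i - 1 : ℤ) : ℝ) * (2 * ellipticK k))
    rw [show u + ((-i - 1 : ℤ) : ℝ) * (2 * ellipticK k) + 2 * ellipticK k
      = u + ((-i : ℤ) : ℝ) * (2 * ellipticK k) by push_cast; ring, ih] at this
    push_cast at this ⊢
    linarith

theorem injective_jacobiAm (hk : k ∈ Set.Ioo (0 : ℝ) 1) : Function.Injective (jacobiAm k) :=
  Function.LeftInverse.injective (ellipticF_jacobiAm hk)

theorem contDiffOn_ellipticF :
    ContDiffOn ℝ 1 (Function.uncurry ellipticF) (Set.Ioo (0 : ℝ) 1 ×ˢ Set.univ) := by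
  have hpos : ∀ p ∈ Set.Ioo (0 : ℝ) 1 ×ˢ (Set.univ : Set ℝ),
      0 < 1 - p.1 ^ 2 * Real.sin p.2 ^ 2 := fun p hp => one_sub_sq_mul_sin_sq_pos hp.1 p.2
  have c0 : ContinuousOn (Function.uncurry fun k s : ℝ =>
      k * Real.sin s ^ 2 / (√(1 - k ^ 2 * Real.sin s ^ 2) * (1 - k ^ 2 * Real.sin s ^ 2)))
      (Set.Ioo (0 : ℝ) 1 ×ˢ Set.univ) := by
    refine ContinuousOn.div (by fun_prop) (by fun_prop) fun p hp => ?_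
    exact mul_ne_zero (Real.sqrt_pos.2 (hpos p hp)).ne' (hpos p hp).ne'
  refine contDiffOn_one_of_partials (isOpen_Ioo.prod isOpen_univ)
    (f₁ := fun k x => ∫ s in (0 : ℝ)..x,
      k * Real.sin s ^ 2 / (√(1 - k ^ 2 * Real.sin s ^ 2) * (1 - k ^ 2 * Real.sin s ^ 2)))
    (f₂ := fun k x => 1 / √(1 - k ^ 2 * Real.sin x ^ 2)) ?_ ?_ ?_ ?_
  · intro k x hkx
    refine hasDerivAt_intervalIntegral_of_continuousOn isOpen_Ioo
      (f := fun k s => 1 / √(1 - k ^ 2 * Real.sin s ^ 2))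
      (fun k hk => continuous_ellipticF_integrand hk) c0 (fun κ hκ s => ?_) 0 x hkx.1
    have hp := one_sub_sq_mul_sin_sq_pos hκ s
    have h1 : HasDerivAt (fun κ => 1 - κ ^ 2 * Real.sin s ^ 2)
        (-(2 * κ * Real.sin s ^ 2)) κ := by
      simpa using (((hasDerivAt_id κ).fun_pow 2).mul_const (Real.sin s ^ 2)).const_sub 1
    have h2 := (h1.sqrt hp.ne').fun_inv (Real.sqrt_pos.2 hp).ne'
    simp only [one_div]
    refine h2.congr_deriv ?_
    rw [Real.sq_sqrt hp.le]
    have := (Real.sqrt_pos.2 hp).ne'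
    have := hp.ne'
    field_simp
  · intro k x hkx
    exact hasDerivAt_ellipticF hkx.1 x
  · exact continuousOn_intervalIntegral_strip c0 0
  · refine ContinuousOn.div (by fun_prop) (by fun_prop) fun p hp => ?_
    exact (Real.sqrt_pos.2 (hpos p hp)).ne'

theorem contDiffOn_ellipticK : ContDiffOn ℝ 1 ellipticK (Set.Ioo (0 : ℝ) 1) := by
  have : ContDiffOn ℝ 1 (fun k : ℝ => ((k, Real.pi / 2) : ℝ × ℝ)) (Set.Ioo (0 : ℝ) 1) := by
    fun_prop
  exact contDiffOn_ellipticF.comp this fun k hk => ⟨hk, trivial⟩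

/-- Joint smoothness in modulus and argument comes from the inverse function theorem for `(k, x) ↦
(k, F(k, x))`. Its derivative is triangular with diagonal entries `1` and `∂F/∂x > 0`. -/
theorem contDiffOn_jacobiAm :
    ContDiffOn ℝ 1 (Function.uncurry jacobiAm) (Set.Ioo (0 : ℝ) 1 ×ˢ Set.univ) := by
  have hopen : IsOpen (Set.Ioo (0 : ℝ) 1 ×ˢ (Set.univ : Set ℝ)) := isOpen_Ioo.prod isOpen_univ
  rintro ⟨k, u⟩ ⟨hk, -⟩
  refine ContDiffAt.contDiffWithinAt ?_
  let Φ : ℝ × ℝ → ℝ × ℝ := fun p => (p.1, ellipticF p.1 p.2)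
  let a : ℝ × ℝ := (k, jacobiAm k u)
  have ha : a ∈ Set.Ioo (0 : ℝ) 1 ×ˢ (Set.univ : Set ℝ) := ⟨hk, trivial⟩
  have hF : ContDiffAt ℝ 1 (Function.uncurry ellipticF) a :=
    contDiffOn_ellipticF.contDiffAt (hopen.mem_nhds ha)
  have hΦ : ContDiffAt ℝ 1 Φ a := contDiffAt_fst.prodMk hF
  set D := fderiv ℝ (Function.uncurry ellipticF) a with hD
  have hDF : HasFDerivAt (Function.uncurry ellipticF) D a :=
    (hF.differentiableAt one_ne_zero).hasFDerivAt
  set d : ℝ := 1 / √(1 - k ^ 2 * Real.sin (jacobiAm k u) ^ 2) with hd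
  have hdpos : 0 < d := one_pos.trans_le (one_le_ellipticF_integrand hk _)
  have hD2 : D (0, 1) = d := by
    have h1 : HasDerivAt (fun x : ℝ => ((k, x) : ℝ × ℝ)) (0, 1) (jacobiAm k u) :=
      (hasDerivAt_const _ _).prodMk (hasDerivAt_id _)
    have h2 := hDF.comp_hasDerivAt (jacobiAm k u) h1
    exact h2.unique (hasDerivAt_ellipticF hk _)
  -- The entry `c = ∂F/∂k` needs no formula: only the diagonal decides invertibility.
  obtain ⟨c, hDx⟩ : ∃ c : ℝ, ∀ x y : ℝ, D (x, y) = x * c + y * d := by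
    refine ⟨D (1, 0), fun x y => ?_⟩
    have : ((x, y) : ℝ × ℝ) = x • (1, 0) + y • (0, 1) := by simp
    rw [this, map_add, map_smul, map_smul, hD2]; simp
  let e : (ℝ × ℝ) ≃L[ℝ] (ℝ × ℝ) := ContinuousLinearEquiv.equivOfInverse
    ((ContinuousLinearMap.fst ℝ ℝ ℝ).prod D)
    ((ContinuousLinearMap.fst ℝ ℝ ℝ).prod (d⁻¹ • (ContinuousLinearMap.snd ℝ ℝ ℝ
      - c • ContinuousLinearMap.fst ℝ ℝ ℝ)))
    (by
      rintro ⟨x, y⟩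
      ext
      · simp
      · simp [hDx]; field_simp; ring)
    (by
      rintro ⟨x, y⟩
      ext
      · simp
      · simp [hDx]; field_simp; ring)
  have he : HasFDerivAt Φ (e : ℝ × ℝ →L[ℝ] ℝ × ℝ) a := hasFDerivAt_fst.prodMk hDF
  have hs := hΦ.hasStrictFDerivAt' he one_ne_zero
  have hinv := hΦ.to_localInverse he one_ne_zero
  have hΦa : Φ a = (k, u) := by simp [Φ, a, ellipticF_jacobiAm hk]
  rw [hΦa] at hinv
  refine hinv.snd.congr_of_eventuallyEq ?_
  have h1 := hs.eventually_right_inverse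
  rw [hΦa] at h1
  filter_upwards [h1, hopen.mem_nhds (show (k, u) ∈ _ from ⟨hk, trivial⟩)] with y hy hyU
  obtain ⟨e1, e2⟩ := Prod.ext_iff.1 hy
  change _ = (hs.localInverse Φ e a y).2
  set z := hs.localInverse Φ e a y
  simp only [Φ] at e1 e2
  change jacobiAm y.1 y.2 = z.2
  rw [← e1, ← e2, jacobiAm_ellipticF (e1 ▸ hyU.1)]

end Jacobi

/-! ## The orbits of the unperturbed oscillator, parametrized by modulus and angle -/

namespace DuffingRegion

variable {R : DuffingRegion} {k : ℝ}

theorem mem_Ioo_of_mem_moduli (hk : k ∈ R.moduli) : k ∈ Set.Ioo (0 : ℝ) 1 := by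
  cases R with
  | rightWell => exact hk
  | leftWell => exact hk
  | outer => exact ⟨lt_trans (by positivity) hk.1, hk.2⟩

theorem isOpen_moduli : IsOpen R.moduli := by
  cases R <;> exact isOpen_Ioo

theorem ordConnected_moduli : R.moduli.OrdConnected := by
  cases R <;> exact Set.ordConnected_Ioo

theorem two_sub_sq_pos (hk : k ∈ Set.Ioo (0 : ℝ) 1) : 0 < 2 - k ^ 2 := by
  nlinarith [hk.1, hk.2]

theorem two_mul_sq_sub_one_pos (hk : k ∈ outer.moduli) : 0 < 2 * k ^ 2 - 1 := by
  have h1 : 1 / √2 < k := hk.1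
  have h2 : (1 / √2) ^ 2 < k ^ 2 := by
    gcongr
  rw [div_pow, Real.sq_sqrt (by norm_num)] at h2
  linarith

theorem freq_pos (hk : k ∈ R.moduli) : 0 < R.freq k := by
  have hk' := mem_Ioo_of_mem_moduli hk
  have hK := ellipticK_pos hk'
  have h2 := two_sub_sq_pos hk'
  cases R with
  | rightWell => simp only [freq]; positivity
  | leftWell => simp only [freq]; positivity
  | outer => have := two_mul_sq_sub_one_pos hk; simp only [freq]; positivity

/-- `K(k) / π` in the wells, `2 K(k) / π` outside: the argument of the Jacobi functions is this
multiple of the angle. -/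
noncomputable def angleScale : DuffingRegion → ℝ → ℝ
  | rightWell, k => 2 * ellipticK k / (2 * Real.pi)
  | leftWell, k => 2 * ellipticK k / (2 * Real.pi)
  | outer, k => 4 * ellipticK k / (2 * Real.pi)

theorem contDiffOn_angleScale : ContDiffOn ℝ 1 R.angleScale R.moduli := by
  have hK : ContDiffOn ℝ 1 ellipticK R.moduli :=
    contDiffOn_ellipticK.mono fun k hk => mem_Ioo_of_mem_moduli hk
  cases R <;> exact (contDiffOn_const.mul hK).div_const _

theorem contDiffOn_freq : ContDiffOn ℝ 1 R.freq R.moduli := by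
  have hK : ContDiffOn ℝ 1 ellipticK R.moduli :=
    contDiffOn_ellipticK.mono fun k hk => mem_Ioo_of_mem_moduli hk
  have hKpos : ∀ k ∈ R.moduli, ellipticK k ≠ 0 :=
    fun k hk => (ellipticK_pos (mem_Ioo_of_mem_moduli hk)).ne'
  have h2 : ∀ k ∈ R.moduli, 2 - k ^ 2 ≠ 0 :=
    fun k hk => (two_sub_sq_pos (mem_Ioo_of_mem_moduli hk)).ne'
  have h2' : ∀ k ∈ R.moduli, √(2 - k ^ 2) ≠ 0 :=
    fun k hk => (Real.sqrt_pos.2 (two_sub_sq_pos (mem_Ioo_of_mem_moduli hk))).ne'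
  cases R with
  | rightWell =>
    exact contDiffOn_const.div ((contDiffOn_const.mul hK).mul
      (ContDiffOn.sqrt (by fun_prop) h2))
      fun k hk => mul_ne_zero (mul_ne_zero two_ne_zero (hKpos k hk)) (h2' k hk)
  | leftWell =>
    exact contDiffOn_const.div ((contDiffOn_const.mul hK).mul
      (ContDiffOn.sqrt (by fun_prop) h2))
      fun k hk => mul_ne_zero (mul_ne_zero two_ne_zero (hKpos k hk)) (h2' k hk)
  | outer =>
    exact contDiffOn_const.div ((contDiffOn_const.mul hK).mul
      (ContDiffOn.sqrt (by fun_prop) fun k hk => (two_mul_sq_sub_one_pos hk).ne'))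
      fun k hk => mul_ne_zero (mul_ne_zero four_ne_zero (hKpos k hk))
        (Real.sqrt_pos.2 (two_mul_sq_sub_one_pos hk)).ne'

theorem contDiffOn_jacobiAm_angleScale :
    ContDiffOn ℝ 1 (fun p : ℝ × ℝ => jacobiAm p.1 (R.angleScale p.1 * p.2))
      (R.moduli ×ˢ Set.univ) := by
  have h : ContDiffOn ℝ 1 (fun p : ℝ × ℝ => ((p.1, R.angleScale p.1 * p.2) : ℝ × ℝ))
      (R.moduli ×ˢ Set.univ) :=
    contDiffOn_fst.prodMk
      ((contDiffOn_angleScale.comp contDiffOn_fst fun p hp => hp.1).mul contDiffOn_snd)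
  exact contDiffOn_jacobiAm.comp h fun p hp => ⟨mem_Ioo_of_mem_moduli hp.1, trivial⟩

theorem contDiffOn_jacobiSn_angleScale :
    ContDiffOn ℝ 1 (fun p : ℝ × ℝ => jacobiSn p.1 (R.angleScale p.1 * p.2))
      (R.moduli ×ˢ Set.univ) := contDiffOn_jacobiAm_angleScale.sin

theorem contDiffOn_jacobiCn_angleScale :
    ContDiffOn ℝ 1 (fun p : ℝ × ℝ => jacobiCn p.1 (R.angleScale p.1 * p.2))
      (R.moduli ×ˢ Set.univ) := contDiffOn_jacobiAm_angleScale.cos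

theorem contDiffOn_jacobiDn_angleScale :
    ContDiffOn ℝ 1 (fun p : ℝ × ℝ => jacobiDn p.1 (R.angleScale p.1 * p.2))
      (R.moduli ×ˢ Set.univ) :=
  ContDiffOn.sqrt (contDiffOn_const.sub ((contDiffOn_fst.pow 2).mul
    (contDiffOn_jacobiSn_angleScale.pow 2)))
    fun _ hp => (one_sub_sq_mul_sin_sq_pos (mem_Ioo_of_mem_moduli hp.1) _).ne'

theorem contDiffOn_orbitQ1 :
    ContDiffOn ℝ 1 (Function.uncurry R.orbitQ1) (R.moduli ×ˢ Set.univ) := by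
  have hw : R ≠ outer → ContDiffOn ℝ 1 (fun p : ℝ × ℝ => √(2 / (2 - p.1 ^ 2)))
      (R.moduli ×ˢ Set.univ) := by
    intro _
    have h2 : ∀ p ∈ R.moduli ×ˢ (Set.univ : Set ℝ), 0 < 2 - p.1 ^ 2 :=
      fun p hp => two_sub_sq_pos (mem_Ioo_of_mem_moduli hp.1)
    exact ContDiffOn.sqrt (contDiffOn_const.div (by fun_prop) fun p hp => (h2 p hp).ne')
      fun p hp => (div_pos two_pos (h2 p hp)).ne'
  cases R with
  | rightWell => exact (hw nofun).mul (contDiffOn_jacobiDn_angleScale (R := rightWell))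
  | leftWell => exact ((hw nofun).mul (contDiffOn_jacobiDn_angleScale (R := leftWell))).neg
  | outer =>
    refine ContDiffOn.mul ?_ (contDiffOn_jacobiCn_angleScale (R := outer))
    have h2 : ∀ p ∈ outer.moduli ×ˢ (Set.univ : Set ℝ), 0 < 2 * p.1 ^ 2 - 1 :=
      fun p hp => two_mul_sq_sub_one_pos hp.1
    refine ContDiffOn.sqrt (ContDiffOn.div (by fun_prop) (by fun_prop)
      fun p hp => (h2 p hp).ne') fun p hp => (div_pos ?_ (h2 p hp)).ne'
    have := (mem_Ioo_of_mem_moduli hp.1).1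
    positivity

theorem contDiffOn_orbitQ2 :
    ContDiffOn ℝ 1 (Function.uncurry R.orbitQ2) (R.moduli ×ˢ Set.univ) := by
  have hw : R ≠ outer → ContDiffOn ℝ 1 (fun p : ℝ × ℝ => √2 * p.1 ^ 2 / (2 - p.1 ^ 2))
      (R.moduli ×ˢ Set.univ) := by
    intro _
    exact ContDiffOn.div (by fun_prop) (by fun_prop)
      fun p hp => (two_sub_sq_pos (mem_Ioo_of_mem_moduli hp.1)).ne'
  cases R with
  | rightWell =>
    exact ((hw nofun).neg.mul (contDiffOn_jacobiCn_angleScale (R := rightWell))).mul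
      (contDiffOn_jacobiSn_angleScale (R := rightWell))
  | leftWell =>
    exact ((hw nofun).mul (contDiffOn_jacobiCn_angleScale (R := leftWell))).mul
      (contDiffOn_jacobiSn_angleScale (R := leftWell))
  | outer =>
    refine ContDiffOn.mul (ContDiffOn.mul ?_ (contDiffOn_jacobiSn_angleScale (R := outer)))
      (contDiffOn_jacobiDn_angleScale (R := outer))
    exact (ContDiffOn.div (by fun_prop) (by fun_prop)
      fun p hp => (two_mul_sq_sub_one_pos hp.1).ne').neg

theorem sqrt_two_div_two_sub_sq (hk : k ∈ Set.Ioo (0 : ℝ) 1) :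
    √(2 / (2 - k ^ 2)) = √2 / √(2 - k ^ 2) := Real.sqrt_div' _ (two_sub_sq_pos hk).le

theorem sqrt_outer_amplitude (hk : k ∈ outer.moduli) :
    √(2 * k ^ 2 / (2 * k ^ 2 - 1)) = √2 * k / √(2 * k ^ 2 - 1) := by
  rw [Real.sqrt_div' _ (two_mul_sq_sub_one_pos hk).le, Real.sqrt_mul' _ (sq_nonneg k),
    Real.sqrt_sq (mem_Ioo_of_mem_moduli hk).1.le]

theorem hasDerivAt_orbitQ1 (hk : k ∈ R.moduli) (φ : ℝ) :
    HasDerivAt (R.orbitQ1 k) (R.orbitQ2 k φ / R.freq k) φ := by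
  have hk' := mem_Ioo_of_mem_moduli hk
  have hK := ellipticK_pos hk'
  have hs : HasDerivAt (fun φ => R.angleScale k * φ) (R.angleScale k) φ := by
    simpa using (hasDerivAt_id φ).const_mul (R.angleScale k)
  have h2 := two_sub_sq_pos hk'
  have hr := Real.sqrt_pos.2 h2
  have hr2 := Real.sq_sqrt h2.le
  have hπ := Real.pi_pos
  cases R with
  | rightWell =>
    refine (((hasDerivAt_jacobiDn hk' _).comp φ hs).const_mul _).congr_deriv ?_
    simp only [orbitQ2, freq, angleScale, sqrt_two_div_two_sub_sq hk']
    -- Writing `2 - k²` as `r²` leaves a rational identity in `r`.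
    generalize √(2 - k ^ 2) = r at *
    rw [← hr2]
    field_simp
  | leftWell =>
    refine (((hasDerivAt_jacobiDn hk' _).comp φ hs).const_mul _).neg.congr_deriv ?_
    simp only [orbitQ2, freq, angleScale, sqrt_two_div_two_sub_sq hk']
    generalize √(2 - k ^ 2) = r at *
    rw [← hr2]
    field_simp
  | outer =>
    refine (((hasDerivAt_jacobiCn hk' _).comp φ hs).const_mul _).congr_deriv ?_
    simp only [orbitQ2, freq, angleScale, sqrt_outer_amplitude hk]
    have h3 := two_mul_sq_sub_one_pos hk
    have hr := Real.sqrt_pos.2 h3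
    have hr2 := Real.sq_sqrt h3.le
    generalize √(2 * k ^ 2 - 1) = r at *
    rw [← hr2]
    field_simp

theorem hasDerivAt_orbitQ2 (hk : k ∈ R.moduli) (φ : ℝ) :
    HasDerivAt (R.orbitQ2 k) ((R.orbitQ1 k φ - R.orbitQ1 k φ ^ 3) / R.freq k) φ := by
  have hk' := mem_Ioo_of_mem_moduli hk
  have hK := ellipticK_pos hk'
  have hs : HasDerivAt (fun φ => R.angleScale k * φ) (R.angleScale k) φ := by
    simpa using (hasDerivAt_id φ).const_mul (R.angleScale k)
  have h2 := two_sub_sq_pos hk'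
  have hr := Real.sqrt_pos.2 h2
  have hr2 := Real.sq_sqrt h2.le
  have hπ := Real.pi_pos
  have h22 : √2 ^ 2 = 2 := Real.sq_sqrt (by norm_num)
  have hs2 : (0 : ℝ) < √2 := by positivity
  have hdn := jacobiDn_sq hk' (R.angleScale k * φ)
  have hsc := jacobiSn_sq_add_jacobiCn_sq k (R.angleScale k * φ)
  have hsn := (hasDerivAt_jacobiSn hk' _).comp φ hs
  have hcn := (hasDerivAt_jacobiCn hk' _).comp φ hs
  have hdn' := (hasDerivAt_jacobiDn hk' _).comp φ hs
  cases R with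
  | rightWell =>
    refine ((hcn.const_mul _).mul hsn).congr_deriv ?_
    simp only [orbitQ1, freq, sqrt_two_div_two_sub_sq hk', Function.comp_def]
    simp only [angleScale] at *
    generalize √(2 - k ^ 2) = r at *
    generalize jacobiSn k _ = s at *
    generalize jacobiCn k _ = c at *
    generalize jacobiDn k _ = d at *
    rw [← hr2]
    field_simp
    -- A polynomial identity modulo `r² = 2 - k²`, `√2² = 2`, `dn² = 1 - k² sn²` and `sn² + cn² =
    -- 1`.
    linear_combination -d * hr2 + d ^ 3 * h22 + 2 * d * hdn - d * k ^ 2 * hsc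
  | leftWell =>
    refine ((hcn.const_mul _).mul hsn).congr_deriv ?_
    simp only [orbitQ1, freq, sqrt_two_div_two_sub_sq hk', Function.comp_def]
    simp only [angleScale] at *
    generalize √(2 - k ^ 2) = r at *
    generalize jacobiSn k _ = s at *
    generalize jacobiCn k _ = c at *
    generalize jacobiDn k _ = d at *
    rw [← hr2]
    field_simp
    linear_combination d * hr2 - d ^ 3 * h22 - 2 * d * hdn + d * k ^ 2 * hsc
  | outer =>
    refine ((hsn.const_mul _).mul hdn').congr_deriv ?_
    simp only [orbitQ1, freq, sqrt_outer_amplitude hk, Function.comp_def]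
    simp only [angleScale] at *
    have h3 := two_mul_sq_sub_one_pos hk
    have hr := Real.sqrt_pos.2 h3
    have hr2 := Real.sq_sqrt h3.le
    generalize √(2 * k ^ 2 - 1) = r at *
    generalize jacobiSn k _ = s at *
    generalize jacobiCn k _ = c at *
    generalize jacobiDn k _ = d at *
    rw [← hr2]
    field_simp
    linear_combination k * c * (-hdn - hr2 + k ^ 2 * c ^ 2 * h22 + 2 * k ^ 2 * hsc)

theorem duffingH_orbit (hk : k ∈ R.moduli) (φ : ℝ) :
    duffingH (R.orbitQ1 k φ) (R.orbitQ2 k φ) = R.energy k := by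
  have hk' := mem_Ioo_of_mem_moduli hk
  have h2 := two_sub_sq_pos hk'
  have hdn := jacobiDn_sq hk' (R.angleScale k * φ)
  have hsc := jacobiSn_sq_add_jacobiCn_sq k (R.angleScale k * φ)
  have h22 : √2 ^ 2 = 2 := Real.sq_sqrt (by norm_num)
  have hA := Real.sq_sqrt (div_pos two_pos h2).le
  have hH : ∀ x y : ℝ, duffingH x y = y ^ 2 / 2 - x ^ 2 / 2 + (x ^ 2) ^ 2 / 4 := by
    intro x y; rw [duffingH]; ring
  rw [hH]
  cases R with
  | rightWell =>
    simp only [orbitQ1, orbitQ2, energy, angleScale, mul_pow, neg_sq, hA, div_pow, h22] at *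
    rw [hdn, eq_sub_iff_add_eq'.2 hsc]
    field_simp
    ring
  | leftWell =>
    simp only [orbitQ1, orbitQ2, energy, angleScale, mul_pow, neg_sq, hA, div_pow, h22] at *
    rw [hdn, eq_sub_iff_add_eq'.2 hsc]
    field_simp
    ring
  | outer =>
    have h3 := two_mul_sq_sub_one_pos hk
    have hA' := Real.sq_sqrt (show (0 : ℝ) ≤ 2 * k ^ 2 / (2 * k ^ 2 - 1) by positivity)
    simp only [orbitQ1, orbitQ2, energy, angleScale, mul_pow, neg_sq, hA', div_pow, h22] at *
    rw [hdn, eq_sub_iff_add_eq'.2 hsc]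
    field_simp
    ring

/-- Energy is increasing in `k` in the wells and decreasing outside; only the nonvanishing slope
matters, making the modulus a smooth coordinate transverse to the orbits. -/
theorem exists_hasStrictDerivAt_energy (hk : k ∈ R.moduli) :
    ∃ e : ℝ, e ≠ 0 ∧ HasStrictDerivAt R.energy e k := by
  have hk' := mem_Ioo_of_mem_moduli hk
  have h2 := two_sub_sq_pos hk'
  have hk0 := hk'.1
  have hsq : HasStrictDerivAt (fun k : ℝ => k ^ 2) (2 * k) k := by
    simpa using (hasStrictDerivAt_id k).fun_pow 2
  have hwell : HasStrictDerivAt (fun k : ℝ => -(1 - k ^ 2) / (2 - k ^ 2) ^ 2)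
      (2 * k ^ 3 / (2 - k ^ 2) ^ 3) k := by
    refine ((hsq.const_sub 1).fun_neg.fun_div ((hsq.const_sub 2).fun_pow 2)
      (pow_pos h2 2).ne').congr_deriv ?_
    field_simp
    ring
  cases R with
  | rightWell => exact ⟨_, by positivity, hwell⟩
  | leftWell => exact ⟨_, by positivity, hwell⟩
  | outer =>
    have h3 := two_mul_sq_sub_one_pos hk
    refine ⟨-(2 * k / (2 * k ^ 2 - 1) ^ 3), (neg_neg_of_pos (by positivity)).ne, ?_⟩
    have h4 : HasStrictDerivAt (fun k : ℝ => 2 * k ^ 2 - 1) (2 * (2 * k)) k :=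
      (hsq.const_mul 2).sub_const 1
    refine ((hsq.fun_mul (hsq.const_sub 1)).fun_div (h4.fun_pow 2) (pow_pos h3 2).ne').congr_deriv ?_
    field_simp
    ring

/-- One turn of the angle is `2K` in a well, where `dn` and `sn cn` already repeat, and `4K`
outside, where `cn` needs a full turn of the amplitude. -/
theorem jacobiAm_angleScale_add_two_pi (hk : k ∈ R.moduli) (φ : ℝ) :
    jacobiAm k (R.angleScale k * (φ + 2 * Real.pi)) = jacobiAm k (R.angleScale k * φ) +
      (match R with
        | rightWell => Real.pi
        | leftWell => Real.pi
        | outer => 2 * Real.pi) := by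
  have hk' := mem_Ioo_of_mem_moduli hk
  cases R with
  | rightWell =>
    rw [← jacobiAm_add_two_mul_ellipticK hk']
    congr 1; simp only [angleScale]; field_simp
  | leftWell =>
    rw [← jacobiAm_add_two_mul_ellipticK hk']
    congr 1; simp only [angleScale]; field_simp
  | outer =>
    have := jacobiAm_add_int_mul hk' (outer.angleScale k * φ) 2
    push_cast at this
    rw [← this]
    congr 1; simp only [angleScale]; field_simp; ring

theorem periodic_orbitQ1 (hk : k ∈ R.moduli) :
    Function.Periodic (R.orbitQ1 k) (2 * Real.pi) := by
  intro φ
  have := jacobiAm_angleScale_add_two_pi hk φ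
  cases R <;> simp only [angleScale] at this <;>
    simp [orbitQ1, jacobiCn, jacobiDn, jacobiSn, this, Real.sin_add_pi]

theorem periodic_orbitQ2 (hk : k ∈ R.moduli) :
    Function.Periodic (R.orbitQ2 k) (2 * Real.pi) := by
  intro φ
  have := jacobiAm_angleScale_add_two_pi hk φ
  cases R <;> simp only [angleScale] at this <;>
    simp [orbitQ2, jacobiCn, jacobiDn, jacobiSn, this, Real.sin_add_pi, Real.cos_add_pi]

end DuffingRegion

/-! ### The phase point determines the angle modulo `2π` -/

theorem exists_int_of_cos_eq_of_sin_eq {x y : ℝ} (hc : Real.cos x = Real.cos y)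
    (hs : Real.sin x = Real.sin y) : ∃ l : ℤ, y = x + l * (2 * Real.pi) := by
  obtain ⟨l, hl⟩ := Real.Angle.angle_eq_iff_two_pi_dvd_sub.1 (Real.Angle.cos_sin_inj hc.symm hs.symm)
  exact ⟨l, by linarith⟩

namespace DuffingRegion

variable {R : DuffingRegion} {k : ℝ}

/-- `dn` determines `sn²`, hence `cos (2 am)`, and `cn sn` determines `sin (2 am)`. So the amplitude
is fixed modulo `π`, and the argument modulo `2K`. -/
theorem exists_int_of_jacobi_eq (hk : k ∈ Set.Ioo (0 : ℝ) 1) {u v : ℝ}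
    (hd : jacobiDn k u = jacobiDn k v)
    (hsc : jacobiCn k u * jacobiSn k u = jacobiCn k v * jacobiSn k v) :
    ∃ l : ℤ, v = u + l * (2 * ellipticK k) := by
  have h1 : jacobiSn k u ^ 2 = jacobiSn k v ^ 2 := by
    have := jacobiDn_sq hk u
    rw [hd, jacobiDn_sq hk v] at this
    have hk2 : k ^ 2 ≠ 0 := (pow_pos hk.1 2).ne'
    apply mul_left_cancel₀ hk2
    linarith
  simp only [jacobiSn, jacobiCn] at h1 hsc
  obtain ⟨l, hl⟩ := exists_int_of_cos_eq_of_sin_eq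
    (x := 2 * jacobiAm k u) (y := 2 * jacobiAm k v)
    (by rw [Real.cos_two_mul, Real.cos_two_mul, Real.cos_sq', Real.cos_sq', h1])
    (by rw [Real.sin_two_mul, Real.sin_two_mul]; linarith)
  refine ⟨l, injective_jacobiAm hk ?_⟩
  rw [jacobiAm_add_int_mul hk]
  linarith

theorem exists_int_of_orbit_eq (hk : k ∈ R.moduli) {φ φ' : ℝ}
    (h1 : R.orbitQ1 k φ = R.orbitQ1 k φ') (h2 : R.orbitQ2 k φ = R.orbitQ2 k φ') :
    ∃ l : ℤ, φ' = φ + l * (2 * Real.pi) := by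
  have hk' := mem_Ioo_of_mem_moduli hk
  have hK := ellipticK_pos hk'
  have ht := two_sub_sq_pos hk'
  have hk0 := hk'.1
  have hA : √(2 / (2 - k ^ 2)) ≠ 0 := (Real.sqrt_pos.2 (by positivity)).ne'
  have hB : √2 * k ^ 2 / (2 - k ^ 2) ≠ 0 := by positivity
  cases R with
  | rightWell =>
    simp only [orbitQ1, orbitQ2, mul_assoc] at h1 h2
    obtain ⟨l, hl⟩ := exists_int_of_jacobi_eq hk' (mul_left_cancel₀ hA h1)
      (mul_left_cancel₀ (neg_ne_zero.2 hB) h2)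
    refine ⟨l, ?_⟩
    field_simp at hl ⊢
    linarith
  | leftWell =>
    simp only [orbitQ1, orbitQ2, mul_assoc] at h1 h2
    obtain ⟨l, hl⟩ := exists_int_of_jacobi_eq hk' (mul_left_cancel₀ hA (neg_injective h1))
      (mul_left_cancel₀ hB h2)
    refine ⟨l, ?_⟩
    field_simp at hl ⊢
    linarith
  | outer =>
    have h3 := two_mul_sq_sub_one_pos hk
    have hA : √(2 * k ^ 2 / (2 * k ^ 2 - 1)) ≠ 0 := (Real.sqrt_pos.2 (by positivity)).ne'
    have hB : -(√2 * k / (2 * k ^ 2 - 1)) ≠ 0 := neg_ne_zero.2 (by positivity)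
    simp only [orbitQ1, orbitQ2, mul_assoc] at h1 h2
    have hc := mul_left_cancel₀ hA h1
    have hsd := mul_left_cancel₀ hB h2
    set u := 4 * ellipticK k / (2 * Real.pi) * φ with hu
    set v := 4 * ellipticK k / (2 * Real.pi) * φ' with hv
    -- Outside, `cn` gives `sn²` and so `dn > 0`; cancelling it from `sn dn` recovers `sn`, hence
    -- the amplitude modulo `2π`.
    have hs2 : jacobiSn k u ^ 2 = jacobiSn k v ^ 2 := by
      have e1 := jacobiSn_sq_add_jacobiCn_sq k u
      have e2 := jacobiSn_sq_add_jacobiCn_sq k v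
      rw [hc] at e1
      linarith
    have hd : jacobiDn k u = jacobiDn k v := by simp only [jacobiDn, hs2]
    rw [hd] at hsd
    have hs := mul_right_cancel₀ (jacobiDn_pos hk' v).ne' hsd
    obtain ⟨l, hl⟩ := exists_int_of_cos_eq_of_sin_eq hc hs
    have h4 := jacobiAm_add_int_mul hk' u (2 * l)
    push_cast at h4
    rw [show jacobiAm k u + 2 * (l : ℝ) * Real.pi = jacobiAm k v by rw [hl]; ring] at h4
    have h5 := injective_jacobiAm hk' h4
    refine ⟨l, ?_⟩
    rw [hu, hv] at h5
    field_simp at h5 ⊢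
    linarith

end DuffingRegion

/-! ## Partial derivatives of `C¹` functions of two variables -/

section Partial

variable {U : Set ℝ} {f g : ℝ → ℝ → ℝ}

theorem hasDerivAt_fst_of_contDiffOn (hU : IsOpen U)
    (hf : ContDiffOn ℝ 1 (Function.uncurry f) (U ×ˢ Set.univ)) {k : ℝ} (hk : k ∈ U) (x : ℝ) :
    HasDerivAt (fun κ => f κ x) (fderiv ℝ (Function.uncurry f) (k, x) (1, 0)) k := by
  have h1 : HasDerivAt (fun κ : ℝ => ((κ, x) : ℝ × ℝ)) (1, 0) k :=
    (hasDerivAt_id _).prodMk (hasDerivAt_const _ _)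
  have h2 : HasFDerivAt (Function.uncurry f) (fderiv ℝ (Function.uncurry f) (k, x)) (k, x) :=
    ((hf.contDiffAt ((hU.prod isOpen_univ).mem_nhds ⟨hk, trivial⟩)).differentiableAt
      one_ne_zero).hasFDerivAt
  exact h2.comp_hasDerivAt k h1

theorem hasDerivAt_deriv_fst (hU : IsOpen U)
    (hf : ContDiffOn ℝ 1 (Function.uncurry f) (U ×ˢ Set.univ)) {k : ℝ} (hk : k ∈ U) (x : ℝ) :
    HasDerivAt (fun κ => f κ x) (deriv (fun κ => f κ x) k) k :=
  (hasDerivAt_fst_of_contDiffOn hU hf hk x).differentiableAt.hasDerivAt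

theorem continuousOn_deriv_fst (hU : IsOpen U)
    (hf : ContDiffOn ℝ 1 (Function.uncurry f) (U ×ˢ Set.univ)) :
    ContinuousOn (Function.uncurry fun k x => deriv (fun κ => f κ x) k) (U ×ˢ Set.univ) := by
  have h := (hf.continuousOn_fderiv_of_isOpen (hU.prod isOpen_univ) le_rfl).clm_apply
    (continuousOn_const (c := ((1, 0) : ℝ × ℝ)))
  exact h.congr fun p hp => (hasDerivAt_fst_of_contDiffOn hU hf hp.1 p.2).deriv

/-- Symmetry of the mixed second derivative, when `f` and `∂f/∂x` are `C¹`. -/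
theorem hasDerivAt_deriv_fst_of_hasDerivAt_snd (hU : IsOpen U)
    (hf : ContDiffOn ℝ 1 (Function.uncurry f) (U ×ˢ Set.univ))
    (hg : ContDiffOn ℝ 1 (Function.uncurry g) (U ×ˢ Set.univ))
    (hfg : ∀ k ∈ U, ∀ x, HasDerivAt (f k) (g k x) x) {k : ℝ} (hk : k ∈ U) (x : ℝ) :
    HasDerivAt (fun x => deriv (fun κ => f κ x) k) (deriv (fun κ => g κ x) k) x := by
  have hgc : ∀ κ ∈ U, Continuous (g κ) :=
    fun κ hκ => continuous_of_continuousOn_strip hg.continuousOn hκ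
  have hg' := continuousOn_deriv_fst hU hg
  -- Differentiating this representation in `κ` under the integral and then in `x` avoids assuming
  -- that `f` is `C²`.
  have h1 : ∀ κ ∈ U, ∀ x, f κ x = f κ 0 + ∫ s in (0 : ℝ)..x, g κ s := by
    intro κ hκ x
    rw [intervalIntegral.integral_eq_sub_of_hasDerivAt (fun s _ => hfg κ hκ s)
      ((hgc κ hκ).intervalIntegrable _ _)]
    ring
  have h2 : ∀ x, deriv (fun κ => f κ x) k =
      deriv (fun κ => f κ 0) k + ∫ s in (0 : ℝ)..x, deriv (fun κ => g κ s) k := by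
    intro x
    have h3 := (hasDerivAt_deriv_fst hU hf hk 0).add
      (hasDerivAt_intervalIntegral_of_continuousOn hU hgc hg'
        (fun κ hκ s => hasDerivAt_deriv_fst hU hg hκ s) 0 x hk)
    refine (h3.congr_of_eventuallyEq ?_).deriv
    filter_upwards [hU.mem_nhds hk] with κ hκ using h1 κ hκ x
  rw [funext h2]
  exact (hasDerivAt_primitive (continuous_of_continuousOn_strip hg' hk) x).const_add _

end Partial

/-! ## Action-angle variables -/

namespace DuffingRegion

variable {R : DuffingRegion} {k : ℝ}

theorem contDiffOn_energy : ContDiffOn ℝ 1 R.energy R.moduli := by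
  cases R with
  | rightWell =>
    exact ContDiffOn.div (by fun_prop) (by fun_prop)
      fun k hk => (pow_pos (two_sub_sq_pos (mem_Ioo_of_mem_moduli hk)) 2).ne'
  | leftWell =>
    exact ContDiffOn.div (by fun_prop) (by fun_prop)
      fun k hk => (pow_pos (two_sub_sq_pos (mem_Ioo_of_mem_moduli hk)) 2).ne'
  | outer =>
    exact ContDiffOn.div (by fun_prop) (by fun_prop)
      fun k hk => (pow_pos (two_mul_sq_sub_one_pos hk) 2).ne'

theorem hasStrictDerivAt_energy (hk : k ∈ R.moduli) :
    HasStrictDerivAt R.energy (deriv R.energy k) k := by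
  obtain ⟨e, -, h⟩ := exists_hasStrictDerivAt_energy hk
  rwa [h.hasDerivAt.deriv]

theorem deriv_energy_ne_zero (hk : k ∈ R.moduli) : deriv R.energy k ≠ 0 := by
  obtain ⟨e, he, h⟩ := exists_hasStrictDerivAt_energy hk
  rwa [h.hasDerivAt.deriv]

theorem injOn_energy : Set.InjOn R.energy R.moduli :=
  injOn_of_hasDerivAt_ne_zero ordConnected_moduli
    (fun _ hk => (hasStrictDerivAt_energy hk).hasDerivAt) fun _ hk => deriv_energy_ne_zero hk

/-- The derivative of the position with respect to the modulus. -/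
noncomputable def dQ1 (R : DuffingRegion) (k φ : ℝ) : ℝ := deriv (fun κ => R.orbitQ1 κ φ) k

/-- The derivative of the velocity with respect to the modulus. -/
noncomputable def dQ2 (R : DuffingRegion) (k φ : ℝ) : ℝ := deriv (fun κ => R.orbitQ2 κ φ) k

theorem hasDerivAt_dQ1 (hk : k ∈ R.moduli) (φ : ℝ) :
    HasDerivAt (fun κ => R.orbitQ1 κ φ) (R.dQ1 k φ) k :=
  hasDerivAt_deriv_fst isOpen_moduli contDiffOn_orbitQ1 hk φ

theorem hasDerivAt_dQ2 (hk : k ∈ R.moduli) (φ : ℝ) :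
    HasDerivAt (fun κ => R.orbitQ2 κ φ) (R.dQ2 k φ) k :=
  hasDerivAt_deriv_fst isOpen_moduli contDiffOn_orbitQ2 hk φ

theorem hasDerivAt_freq (hk : k ∈ R.moduli) : HasDerivAt R.freq (deriv R.freq k) k :=
  ((contDiffOn_freq.contDiffAt (isOpen_moduli.mem_nhds hk)).differentiableAt
    one_ne_zero).hasDerivAt

theorem continuous_orbitQ1 (hk : k ∈ R.moduli) : Continuous (R.orbitQ1 k) :=
  continuous_of_continuousOn_strip contDiffOn_orbitQ1.continuousOn hk

theorem continuous_orbitQ2 (hk : k ∈ R.moduli) : Continuous (R.orbitQ2 k) :=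
  continuous_of_continuousOn_strip contDiffOn_orbitQ2.continuousOn hk

theorem continuous_dQ1 (hk : k ∈ R.moduli) : Continuous (R.dQ1 k) :=
  continuous_of_continuousOn_strip (continuousOn_deriv_fst isOpen_moduli contDiffOn_orbitQ1) hk

theorem continuous_dQ2 (hk : k ∈ R.moduli) : Continuous (R.dQ2 k) :=
  continuous_of_continuousOn_strip (continuousOn_deriv_fst isOpen_moduli contDiffOn_orbitQ2) hk

theorem hasDerivAt_orbitQ2_div_freq (hk : k ∈ R.moduli) (φ : ℝ) :
    HasDerivAt (fun κ => R.orbitQ2 κ φ / R.freq κ)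
      ((R.dQ2 k φ * R.freq k - R.orbitQ2 k φ * deriv R.freq k) / R.freq k ^ 2) k :=
  (hasDerivAt_dQ2 hk φ).fun_div (hasDerivAt_freq hk) (freq_pos hk).ne'

theorem hasDerivAt_dQ1_angle (hk : k ∈ R.moduli) (φ : ℝ) :
    HasDerivAt (R.dQ1 k)
      ((R.dQ2 k φ * R.freq k - R.orbitQ2 k φ * deriv R.freq k) / R.freq k ^ 2) φ := by
  have hg : ContDiffOn ℝ 1 (Function.uncurry fun κ φ => R.orbitQ2 κ φ / R.freq κ)
      (R.moduli ×ˢ Set.univ) :=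
    contDiffOn_orbitQ2.div (contDiffOn_freq.comp contDiffOn_fst fun p hp => hp.1)
      fun p hp => (freq_pos hp.1).ne'
  have := hasDerivAt_deriv_fst_of_hasDerivAt_snd isOpen_moduli contDiffOn_orbitQ1 hg
    (fun κ hκ x => hasDerivAt_orbitQ1 hκ x) hk φ
  rwa [(hasDerivAt_orbitQ2_div_freq hk φ).deriv] at this

/-- This is the advantage of the angle over time: the period does not depend on `k`, so the modulus
derivative is still periodic. -/
theorem periodic_dQ1 (hk : k ∈ R.moduli) : Function.Periodic (R.dQ1 k) (2 * Real.pi) := by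
  intro φ
  refine Filter.EventuallyEq.deriv_eq ?_
  filter_upwards [isOpen_moduli.mem_nhds hk] with κ hκ using periodic_orbitQ1 hκ φ

/-- Differentiate `H(q₁, q₂) = energy k` in `k`. Divided by the frequency, the right side is the
Jacobian determinant of the orbit parametrization up to sign. -/
theorem deriv_energy_eq (hk : k ∈ R.moduli) (φ : ℝ) :
    deriv R.energy k = R.orbitQ2 k φ * R.dQ2 k φ
      - (R.orbitQ1 k φ - R.orbitQ1 k φ ^ 3) * R.dQ1 k φ := by
  have h1 := hasDerivAt_dQ1 hk φ
  have h2 := hasDerivAt_dQ2 hk φ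
  have h := (((h2.fun_pow 2).div_const 2).fun_sub ((h1.fun_pow 2).div_const 2)).fun_add
    ((h1.fun_pow 4).div_const 4)
  have h' := h.congr_of_eventuallyEq (f₁ := R.energy) (by
    filter_upwards [isOpen_moduli.mem_nhds hk] with κ hκ
    exact (duffingH_orbit hκ φ).symm)
  rw [h'.deriv]
  push_cast
  ring

theorem actionOfModulus_eq (hk : k ∈ R.moduli) :
    R.actionOfModulus k =
      1 / (2 * Real.pi) * ∫ φ in (0 : ℝ)..(2 * Real.pi), R.orbitQ2 k φ ^ 2 / R.freq k := by
  rw [actionOfModulus]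
  congr 2
  funext φ
  rw [(hasDerivAt_orbitQ1 hk φ).deriv]
  ring

/-- If the integral of `q₂²` vanished, the orbit would be at rest, and the angles `0` and `π` would
give the same phase point. -/
theorem actionOfModulus_pos (hk : k ∈ R.moduli) : 0 < R.actionOfModulus k := by
  have hω := freq_pos hk
  have hc := continuous_orbitQ2 hk
  rw [actionOfModulus_eq hk]
  refine mul_pos (by positivity) ?_
  refine intervalIntegral.integral_pos Real.two_pi_pos (by fun_prop) (fun x _ => by positivity) ?_
  by_contra! h
  have hz : ∀ φ ∈ Set.Icc 0 (2 * Real.pi), R.orbitQ2 k φ = 0 := by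
    intro φ hφ
    have h1 := h φ hφ
    have h2 : 0 ≤ R.orbitQ2 k φ ^ 2 / R.freq k := by positivity
    have h3 := le_antisymm h1 h2
    simpa [hω.ne'] using h3
  obtain ⟨c, hc, hc'⟩ := exists_hasDerivAt_eq_slope (R.orbitQ1 k) (fun φ => R.orbitQ2 k φ / R.freq k)
    Real.pi_pos (continuous_orbitQ1 hk).continuousOn fun x _ => hasDerivAt_orbitQ1 hk x
  rw [hz c ⟨hc.1.le, by linarith [hc.2, Real.pi_pos]⟩, zero_div, eq_comm, div_eq_zero_iff] at hc'
  have hq1 : R.orbitQ1 k 0 = R.orbitQ1 k Real.pi := by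
    rcases hc' with h | h
    · linarith
    · linarith [Real.pi_pos]
  have hq2 : R.orbitQ2 k 0 = R.orbitQ2 k Real.pi := by
    rw [hz 0 ⟨le_rfl, Real.two_pi_pos.le⟩, hz Real.pi ⟨Real.pi_pos.le, by linarith [Real.pi_pos]⟩]
  obtain ⟨l, hl⟩ := exists_int_of_orbit_eq hk hq1 hq2
  have h2 : (1 : ℝ) = l * 2 := by
    apply mul_right_cancel₀ Real.pi_pos.ne'
    linarith
  have h3 : (1 : ℤ) = l * 2 := by exact_mod_cast h2
  omega

/-- This is `dI/dH = 1/ω`. The `k`-derivative of the integrand `q₂²/ω` differs from the constant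
`energy'/ω` by the `φ`-derivative of the periodic function `q₂ ∂q₁/∂k`, which integrates to zero. -/
theorem hasDerivAt_actionOfModulus (hk : k ∈ R.moduli) :
    HasDerivAt R.actionOfModulus (deriv R.energy k / R.freq k) k := by
  have hC : ContDiffOn ℝ 1 (Function.uncurry fun κ φ => R.orbitQ2 κ φ ^ 2 / R.freq κ)
      (R.moduli ×ˢ Set.univ) :=
    (contDiffOn_orbitQ2.pow 2).div (contDiffOn_freq.comp contDiffOn_fst fun p hp => hp.1)
      fun p hp => (freq_pos hp.1).ne'
  have h1 := hasDerivAt_intervalIntegral_of_continuousOn isOpen_moduli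
    (fun κ hκ => continuous_of_continuousOn_strip hC.continuousOn hκ)
    (continuousOn_deriv_fst isOpen_moduli hC)
    (fun κ hκ s => hasDerivAt_deriv_fst isOpen_moduli hC hκ s) 0 (2 * Real.pi) hk
  have h2 := (h1.const_mul (1 / (2 * Real.pi))).congr_of_eventuallyEq
    (f₁ := R.actionOfModulus) (by
      filter_upwards [isOpen_moduli.mem_nhds hk] with κ hκ using actionOfModulus_eq hκ)
  refine h2.congr_deriv ?_
  have hω := (freq_pos hk).ne'
  have hZ : ∀ φ, HasDerivAt (fun φ => R.orbitQ2 k φ * R.dQ1 k φ)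
      (deriv (fun κ => R.orbitQ2 κ φ ^ 2 / R.freq κ) k - deriv R.energy k / R.freq k) φ := by
    intro φ
    have h3 := ((hasDerivAt_dQ2 hk φ).fun_pow 2).fun_div (hasDerivAt_freq hk) hω
    refine ((hasDerivAt_orbitQ2 hk φ).fun_mul (hasDerivAt_dQ1_angle hk φ)).congr_deriv ?_
    rw [h3.deriv, deriv_energy_eq hk φ]
    push_cast
    field_simp
    ring
  have hcont := continuous_of_continuousOn_strip (continuousOn_deriv_fst isOpen_moduli hC) hk
  have h4 := intervalIntegral.integral_eq_sub_of_hasDerivAt (a := 0) (b := 2 * Real.pi)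
    (fun φ _ => hZ φ) ((hcont.sub continuous_const).intervalIntegrable _ _)
  have e1 := (periodic_orbitQ2 hk) 0
  have e2 := (periodic_dQ1 hk) 0
  rw [zero_add] at e1 e2
  rw [intervalIntegral.integral_sub (hcont.intervalIntegrable _ _)
    (continuous_const.intervalIntegrable _ _), e1, e2, sub_self, sub_eq_zero] at h4
  rw [h4, intervalIntegral.integral_const, smul_eq_mul, sub_zero]
  have := Real.pi_pos
  field_simp

theorem hasStrictDerivAt_actionOfModulus (hk : k ∈ R.moduli) :
    HasStrictDerivAt R.actionOfModulus (deriv R.energy k / R.freq k) k := by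
  refine hasStrictDerivAt_of_hasDerivAt_of_continuousAt
    (f' := fun k => deriv R.energy k / R.freq k) ?_ ?_
  · filter_upwards [isOpen_moduli.mem_nhds hk] with κ hκ using hasDerivAt_actionOfModulus hκ
  · exact ((contDiffOn_energy.continuousOn_deriv_of_isOpen isOpen_moduli le_rfl).div
      contDiffOn_freq.continuousOn fun κ hκ => (freq_pos hκ).ne').continuousAt
      (isOpen_moduli.mem_nhds hk)

theorem deriv_energy_div_freq_ne_zero (hk : k ∈ R.moduli) : deriv R.energy k / R.freq k ≠ 0 :=
  div_ne_zero (deriv_energy_ne_zero hk) (freq_pos hk).ne'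

theorem injOn_actionOfModulus : Set.InjOn R.actionOfModulus R.moduli :=
  injOn_of_hasDerivAt_ne_zero ordConnected_moduli
    (fun _ hk => hasDerivAt_actionOfModulus hk) fun _ hk => deriv_energy_div_freq_ne_zero hk

theorem modulusOfAction_actionOfModulus (hk : k ∈ R.moduli) :
    R.modulusOfAction (R.actionOfModulus k) = k :=
  injOn_actionOfModulus.leftInvOn_invFunOn hk

theorem modulusOfEnergy_energy (hk : k ∈ R.moduli) : R.modulusOfEnergy (R.energy k) = k :=
  injOn_energy.leftInvOn_invFunOn hk

theorem hasDerivAt_modulusOfAction (hk : k ∈ R.moduli) :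
    HasDerivAt R.modulusOfAction (deriv R.energy k / R.freq k)⁻¹ (R.actionOfModulus k) :=
  (hasStrictDerivAt_invFunOn isOpen_moduli injOn_actionOfModulus hk
    (hasStrictDerivAt_actionOfModulus hk) (deriv_energy_div_freq_ne_zero hk)).hasDerivAt

theorem hasDerivAt_modulusOfEnergy (hk : k ∈ R.moduli) :
    HasDerivAt R.modulusOfEnergy (deriv R.energy k)⁻¹ (R.energy k) :=
  (hasStrictDerivAt_invFunOn isOpen_moduli injOn_energy hk
    (hasStrictDerivAt_energy hk) (deriv_energy_ne_zero hk)).hasDerivAt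

/-- Explicit formulas are available only at actions of orbits; openness lets them be differentiated
with respect to the action. -/
theorem actions_mem_nhds (hk : k ∈ R.moduli) : R.actions ∈ 𝓝 (R.actionOfModulus k) := by
  rw [← (hasStrictDerivAt_actionOfModulus hk).map_nhds_eq (deriv_energy_div_freq_ne_zero hk)]
  exact Filter.image_mem_map (isOpen_moduli.mem_nhds hk)

theorem action_orbit (hk : k ∈ R.moduli) (φ : ℝ) :
    R.action (R.orbitQ1 k φ) (R.orbitQ2 k φ) = R.actionOfModulus k := by
  rw [action, duffingH_orbit hk, modulusOfEnergy_energy hk]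

/-- The action depends on the phase point only through `H`, with `dI/dH = 1/ω` and `∂H/∂q₂ = q₂`. -/
theorem dActionDq2_actionOfModulus (hk : k ∈ R.moduli) (φ : ℝ) :
    R.dActionDq2 (R.actionOfModulus k) φ = R.orbitQ2 k φ / R.freq k := by
  rw [dActionDq2, q1, q2, modulusOfAction_actionOfModulus hk]
  have hH : HasDerivAt (fun y => duffingH (R.orbitQ1 k φ) y) (R.orbitQ2 k φ) (R.orbitQ2 k φ) := by
    have := ((((hasDerivAt_id (R.orbitQ2 k φ)).fun_pow 2).div_const 2).sub_const
      (R.orbitQ1 k φ ^ 2 / 2)).add_const (R.orbitQ1 k φ ^ 4 / 4)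
    refine this.congr_deriv ?_
    simp
  have hm : HasDerivAt R.modulusOfEnergy (deriv R.energy k)⁻¹
      (duffingH (R.orbitQ1 k φ) (R.orbitQ2 k φ)) := by
    rw [duffingH_orbit hk]; exact hasDerivAt_modulusOfEnergy hk
  have ha : HasDerivAt R.actionOfModulus (deriv R.energy k / R.freq k)
      (R.modulusOfEnergy (duffingH (R.orbitQ1 k φ) (R.orbitQ2 k φ))) := by
    rw [duffingH_orbit hk, modulusOfEnergy_energy hk]; exact hasDerivAt_actionOfModulus hk
  have h1 := hm.comp _ hH
  have h2 := HasDerivAt.comp (h := R.modulusOfEnergy ∘ duffingH (R.orbitQ1 k φ)) _ ha h1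
  refine h2.deriv.trans ?_
  have := deriv_energy_ne_zero hk
  field_simp

/-- The right side is `-∂q₁/∂I`, an entry of the inverse of the Jacobian matrix of `(k, φ) ↦ (q₁,
q₂)`. The work lies in identifying the chosen branch `angle` with the second component of the local
inverse. -/
theorem dAngleDq2_actionOfModulus (hk : k ∈ R.moduli) (φ : ℝ) :
    R.dAngleDq2 (R.actionOfModulus k) φ = -(R.dQ1 k φ * (deriv R.energy k / R.freq k)⁻¹) := by
  rw [dAngleDq2, q1, q2, modulusOfAction_actionOfModulus hk]
  have hopen : IsOpen (R.moduli ×ˢ (Set.univ : Set ℝ)) := isOpen_moduli.prod isOpen_univ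
  have hmem : (k, φ) ∈ R.moduli ×ˢ (Set.univ : Set ℝ) := ⟨hk, trivial⟩
  set Δ := deriv R.energy k / R.freq k with hΔ
  have hΔ0 : Δ ≠ 0 := deriv_energy_div_freq_ne_zero hk
  set a := R.dQ1 k φ with ha
  set b := R.orbitQ2 k φ / R.freq k with hb
  set c := R.dQ2 k φ with hc
  set d := (R.orbitQ1 k φ - R.orbitQ1 k φ ^ 3) / R.freq k with hd
  have hdet : b * c - a * d = Δ := by
    rw [hΔ, deriv_energy_eq hk φ, hb, hd]; ring
  let f : ℝ × ℝ → ℝ × ℝ := fun p => (R.orbitQ1 p.1 p.2, R.orbitQ2 p.1 p.2)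
  have key : ∀ (g : ℝ → ℝ → ℝ) (u v : ℝ),
      ContDiffOn ℝ 1 (Function.uncurry g) (R.moduli ×ˢ Set.univ) →
      HasDerivAt (fun κ => g κ φ) u k → HasDerivAt (g k) v φ →
      HasStrictFDerivAt (Function.uncurry g)
        (u • ContinuousLinearMap.fst ℝ ℝ ℝ + v • ContinuousLinearMap.snd ℝ ℝ ℝ) (k, φ) := by
    intro g u v hg hu hv
    have h := (hg.contDiffAt (hopen.mem_nhds hmem)).hasStrictFDerivAt one_ne_zero
    have h1 : HasDerivAt (fun κ : ℝ => ((κ, φ) : ℝ × ℝ)) (1, 0) k :=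
      (hasDerivAt_id _).prodMk (hasDerivAt_const _ _)
    have h2 : HasDerivAt (fun x : ℝ => ((k, x) : ℝ × ℝ)) (0, 1) φ :=
      (hasDerivAt_const _ _).prodMk (hasDerivAt_id _)
    have h3 := h.hasFDerivAt.comp_hasDerivAt k h1
    have h4 := h.hasFDerivAt.comp_hasDerivAt φ h2
    have e1 := HasDerivAt.unique h3 hu
    have e2 := HasDerivAt.unique h4 hv
    have e3 : u • ContinuousLinearMap.fst ℝ ℝ ℝ + v • ContinuousLinearMap.snd ℝ ℝ ℝ =
        fderiv ℝ (Function.uncurry g) (k, φ) := by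
      ext
      · simp [e1]
      · simp [e2]
    rw [e3]
    exact h
  let e : (ℝ × ℝ) ≃L[ℝ] (ℝ × ℝ) := ContinuousLinearEquiv.equivOfInverse
    ((a • ContinuousLinearMap.fst ℝ ℝ ℝ + b • ContinuousLinearMap.snd ℝ ℝ ℝ).prod
      (c • ContinuousLinearMap.fst ℝ ℝ ℝ + d • ContinuousLinearMap.snd ℝ ℝ ℝ))
    (((-d * Δ⁻¹) • ContinuousLinearMap.fst ℝ ℝ ℝ + (b * Δ⁻¹) • ContinuousLinearMap.snd ℝ ℝ ℝ).prod
      ((c * Δ⁻¹) • ContinuousLinearMap.fst ℝ ℝ ℝ + (-a * Δ⁻¹) • ContinuousLinearMap.snd ℝ ℝ ℝ))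
    (by
      rintro ⟨x, y⟩
      ext
      · simp; field_simp; rw [← hdet]; ring
      · simp; field_simp; rw [← hdet]; ring)
    (by
      rintro ⟨x, y⟩
      ext
      · simp; field_simp; rw [← hdet]; ring
      · simp; field_simp; rw [← hdet]; ring)
  have hs : HasStrictFDerivAt f (e : ℝ × ℝ →L[ℝ] ℝ × ℝ) (k, φ) :=
    (key R.orbitQ1 a b contDiffOn_orbitQ1 (hasDerivAt_dQ1 hk φ) (hasDerivAt_orbitQ1 hk φ)).prodMk
      (key R.orbitQ2 c d contDiffOn_orbitQ2 (hasDerivAt_dQ2 hk φ) (hasDerivAt_orbitQ2 hk φ))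
  set g := hs.localInverse f e (k, φ)
  have hg : HasStrictFDerivAt g (e.symm : ℝ × ℝ →L[ℝ] ℝ × ℝ) (f (k, φ)) := hs.to_localInverse
  have hline : HasDerivAt (fun y : ℝ => ((R.orbitQ1 k φ, y) : ℝ × ℝ)) (0, 1) (R.orbitQ2 k φ) :=
    (hasDerivAt_const _ _).prodMk (hasDerivAt_id _)
  have hβ := hg.hasFDerivAt.comp_hasDerivAt (R.orbitQ2 k φ) hline
  have hβ2 : HasDerivAt (fun y => (g (R.orbitQ1 k φ, y)).2) (-a * Δ⁻¹) (R.orbitQ2 k φ) := by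
    refine (hasFDerivAt_snd.comp_hasDerivAt (R.orbitQ2 k φ) hβ).congr_deriv ?_
    change (-d * Δ⁻¹ * 0 + b * Δ⁻¹ * 1, c * Δ⁻¹ * 0 + -a * Δ⁻¹ * 1).2 = -a * Δ⁻¹
    simp
  rw [← neg_mul]
  refine (hβ2.congr_of_eventuallyEq ?_).deriv
  have hg0 : g (R.orbitQ1 k φ, R.orbitQ2 k φ) = (k, φ) := hs.localInverse_apply_image
  have hπ := Real.pi_pos
  -- Nearby points are reached with an admissible modulus and an angle inside the window of the
  -- branch centred at `φ`.
  have hV : R.moduli ×ˢ Set.Ioo (φ - Real.pi) (φ + Real.pi) ∈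
      𝓝 (g (R.orbitQ1 k φ, R.orbitQ2 k φ)) := by
    rw [hg0]
    exact (isOpen_moduli.prod isOpen_Ioo).mem_nhds ⟨hk, by linarith, by linarith⟩
  filter_upwards [hβ.continuousAt hV, hline.continuousAt hs.eventually_right_inverse]
    with y hyV hy
  replace hyV : g (R.orbitQ1 k φ, y) ∈ R.moduli ×ˢ Set.Ioo (φ - Real.pi) (φ + Real.pi) := hyV
  change f (g (R.orbitQ1 k φ, y)) = (R.orbitQ1 k φ, y) at hy
  generalize g (R.orbitQ1 k φ, y) = z at hyV hy
  obtain ⟨κ, β⟩ := z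
  obtain ⟨hκ, hβ3⟩ := hyV
  obtain ⟨hx, hy⟩ := Prod.ext_iff.1 hy
  simp only [f] at hx hy hκ hβ3
  rw [← hx, ← hy, angle]
  simp only [action_orbit hκ, q1, q2, modulusOfAction_actionOfModulus hκ]
  refine Eq.trans (congrArg sInf (Set.ext fun φ' => ?_)) (csInf_singleton β)
  constructor
  · rintro ⟨h1, h2, h3⟩
    obtain ⟨l, hl⟩ := exists_int_of_orbit_eq hκ h2 h3
    -- Two angles of the same point differ by a multiple of `2π`, and the half-open window has
    -- length `2π`.
    have l1 : (l : ℝ) < 1 := by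
      by_contra! hc
      nlinarith [h1.1, hβ3.2]
    have l2 : (-1 : ℝ) < l := by
      by_contra! hc
      nlinarith [h1.2, hβ3.1]
    have l0 : l = 0 := by
      have : l < 1 := by exact_mod_cast l1
      have : -1 < l := by exact_mod_cast l2
      omega
    rw [l0] at hl
    simp at hl
    exact hl.symm
  · rintro rfl
    exact ⟨Set.Ioo_subset_Ico_self hβ3, rfl, rfl⟩

end DuffingRegion

namespace DuffingResonance

variable {P : DuffingResonance} {k : ℝ}

/-! ## Averages over the fast angle -/

theorem thetaAvg_add {f g : ℝ → ℝ} (hf : Continuous f) (hg : Continuous g) :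
    P.thetaAvg (fun θ => f θ + g θ) = P.thetaAvg f + P.thetaAvg g := by
  simp only [thetaAvg]
  rw [intervalIntegral.integral_add (hf.intervalIntegrable _ _) (hg.intervalIntegrable _ _),
    mul_add]

theorem thetaAvg_const_mul (c : ℝ) (f : ℝ → ℝ) :
    P.thetaAvg (fun θ => c * f θ) = c * P.thetaAvg f := by
  simp only [thetaAvg]
  rw [intervalIntegral.integral_const_mul]
  ring

theorem thetaAvg_const (hm : 0 < P.m) (c : ℝ) : P.thetaAvg (fun _ => c) = c := by
  have hm' : (0 : ℝ) < P.m := by exact_mod_cast hm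
  have := Real.pi_pos
  rw [thetaAvg, intervalIntegral.integral_const, smul_eq_mul]
  field_simp
  ring

theorem hasDerivAt_thetaAvg {f f' : ℝ → ℝ → ℝ} (hf : ∀ ψ, Continuous (f ψ))
    (hf' : Continuous (Function.uncurry f')) (hd : ∀ ψ θ, HasDerivAt (fun x => f x θ) (f' ψ θ) ψ)
    (ψ : ℝ) :
    HasDerivAt (fun ψ => P.thetaAvg (f ψ)) (P.thetaAvg (f' ψ)) ψ :=
  (hasDerivAt_intervalIntegral_of_continuousOn isOpen_univ (fun ψ _ => hf ψ)
    hf'.continuousOn (fun ψ _ θ => hd ψ θ) 0 (2 * P.m * Real.pi) (Set.mem_univ ψ)).const_mul _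

theorem continuous_thetaAvg {f : ℝ → ℝ → ℝ} (hf : Continuous (Function.uncurry f)) :
    Continuous fun ψ => P.thetaAvg (f ψ) :=
  continuous_const.mul (intervalIntegral.continuous_parametric_intervalIntegral_of_continuous'
    hf 0 (2 * P.m * Real.pi))

theorem integral_comp_phase (hm : 0 < P.m) (hn : 0 < P.n) (u : ℝ → ℝ) (ψ : ℝ) :
    ∫ θ in (0 : ℝ)..(2 * P.m * Real.pi), u (P.phase ψ θ) =
      P.m / P.n * ∫ s in ψ..(ψ + 2 * Real.pi * P.n), u s := by
  have hm' : (0 : ℝ) < P.m := by exact_mod_cast hm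
  have hn' : (0 : ℝ) < P.n := by exact_mod_cast hn
  simp only [phase]
  rw [intervalIntegral.integral_comp_add_mul u (by positivity), inv_div, smul_eq_mul, mul_zero,
    add_zero]
  congr 3
  field_simp

/-- While `θ` covers `2πm` the phase covers `2πn`, exactly `n` periods of `u`. -/
theorem thetaAvg_comp_phase (hm : 0 < P.m) (hn : 0 < P.n) {u : ℝ → ℝ} (hu : Continuous u)
    (hp : Function.Periodic u (2 * Real.pi)) (ψ : ℝ) :
    P.thetaAvg (fun θ => u (P.phase ψ θ)) =
      1 / (2 * Real.pi) * ∫ s in (0 : ℝ)..(2 * Real.pi), u s := by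
  have hm' : (0 : ℝ) < P.m := by exact_mod_cast hm
  have hn' : (0 : ℝ) < P.n := by exact_mod_cast hn
  have := Real.pi_pos
  have h := hp.intervalIntegral_add_zsmul_eq P.n ψ
    (fun a b => hu.intervalIntegrable a b)
  simp only [natCast_zsmul, nsmul_eq_mul] at h
  rw [thetaAvg, integral_comp_phase hm hn, mul_comm (2 * Real.pi) (P.n : ℝ), h,
    hp.intervalIntegral_add_eq ψ 0, zero_add]
  field_simp

/-- The average of a `2π`-periodic function of the phase against `cos θ` is a single harmonic. -/
theorem exists_thetaAvg_mul_cos (hm : 0 < P.m) (hn : 0 < P.n) {u : ℝ → ℝ} (hu : Continuous u)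
    (hp : Function.Periodic u (2 * Real.pi)) :
    ∃ A B : ℝ, ∀ ψ, P.thetaAvg (fun θ => u (P.phase ψ θ) * Real.cos θ) =
      A * Real.cos (P.m / P.n * ψ) + B * Real.sin (P.m / P.n * ψ) := by
  have hm' : (0 : ℝ) < P.m := by exact_mod_cast hm
  have hn' : (0 : ℝ) < P.n := by exact_mod_cast hn
  set μ : ℝ := P.m / P.n with hμ
  refine ⟨1 / (2 * P.m * Real.pi) * (μ * ∫ s in (0 : ℝ)..(2 * Real.pi * P.n), u s * Real.cos (μ * s)),
    1 / (2 * P.m * Real.pi) * (μ * ∫ s in (0 : ℝ)..(2 * Real.pi * P.n), u s * Real.sin (μ * s)),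
    fun ψ => ?_⟩
  have h1 : (fun θ => u (P.phase ψ θ) * Real.cos θ) =
      fun θ => (fun s => u s * Real.cos (μ * (s - ψ))) (P.phase ψ θ) := by
    funext θ
    simp only [phase, add_sub_cancel_left]
    congr 2
    rw [hμ]
    field_simp
  -- Over `2πn` the cosine advances by `2πm`, so the integral over a period may start at `0`; then
  -- `ψ` enters only through `cos (μ (s - ψ))`.
  have hper : Function.Periodic (fun s => u s * Real.cos (μ * (s - ψ))) (2 * Real.pi * P.n) := by
    intro s
    have e1 : u (s + 2 * Real.pi * P.n) = u s := by
      have := hp.nat_mul P.n s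
      rwa [mul_comm] at this
    have e2 : μ * (s + 2 * Real.pi * P.n - ψ) = μ * (s - ψ) + P.m * (2 * Real.pi) := by
      rw [hμ]; field_simp; ring
    simp only [e1, e2, Real.cos_add_nat_mul_two_pi]
  rw [h1, thetaAvg, integral_comp_phase hm hn (fun s => u s * Real.cos (μ * (s - ψ))) ψ,
    hper.intervalIntegral_add_eq ψ 0, zero_add]
  have h2 : ∀ s, u s * Real.cos (μ * (s - ψ)) =
      Real.cos (μ * ψ) * (u s * Real.cos (μ * s)) + Real.sin (μ * ψ) * (u s * Real.sin (μ * s)) := by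
    intro s
    rw [mul_sub, Real.cos_sub]
    ring
  simp only [h2]
  rw [intervalIntegral.integral_add (Continuous.intervalIntegrable (by fun_prop) _ _)
    (Continuous.intervalIntegrable (by fun_prop) _ _), intervalIntegral.integral_const_mul,
    intervalIntegral.integral_const_mul]
  ring

/-! ## The perturbation in action-angle variables -/

theorem F_actionOfModulus (hk : k ∈ P.region.moduli) (φ θ : ℝ) :
    P.F (P.region.actionOfModulus k) φ θ = P.region.orbitQ2 k φ / P.region.freq k *
      P.g2 (P.region.orbitQ1 k φ) (P.region.orbitQ2 k φ) θ := by
  rw [F, DuffingRegion.dActionDq2_actionOfModulus hk, DuffingRegion.q1, DuffingRegion.q2,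
    DuffingRegion.modulusOfAction_actionOfModulus hk]

theorem G_actionOfModulus (hk : k ∈ P.region.moduli) (φ θ : ℝ) :
    P.G (P.region.actionOfModulus k) φ θ =
      -(P.region.dQ1 k φ * (deriv P.region.energy k / P.region.freq k)⁻¹) *
      P.g2 (P.region.orbitQ1 k φ) (P.region.orbitQ2 k φ) θ := by
  rw [G, DuffingRegion.dAngleDq2_actionOfModulus hk, DuffingRegion.q1, DuffingRegion.q2,
    DuffingRegion.modulusOfAction_actionOfModulus hk]

/-- The chain rule through the modulus: `∂/∂I = (dI/dk)⁻¹ ∂/∂k`. -/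
theorem F'_actionOfModulus (hk : k ∈ P.region.moduli) (φ θ : ℝ) :
    P.F' (P.region.actionOfModulus k) φ θ =
      ((P.region.dQ2 k φ * P.region.freq k - P.region.orbitQ2 k φ * deriv P.region.freq k) /
          P.region.freq k ^ 2 * P.g2 (P.region.orbitQ1 k φ) (P.region.orbitQ2 k φ) θ +
        P.region.orbitQ2 k φ / P.region.freq k *
          (P.η * Real.cos θ * P.region.dQ1 k φ - P.δ * P.region.dQ2 k φ)) *
      (deriv P.region.energy k / P.region.freq k)⁻¹ := by
  have h1 : HasDerivAt (fun κ => P.g2 (P.region.orbitQ1 κ φ) (P.region.orbitQ2 κ φ) θ)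
      (P.η * Real.cos θ * P.region.dQ1 k φ - P.δ * P.region.dQ2 k φ) k :=
    (((DuffingRegion.hasDerivAt_dQ1 hk φ).const_mul _).add_const _).sub
      ((DuffingRegion.hasDerivAt_dQ2 hk φ).const_mul _)
  have h2 := (DuffingRegion.hasDerivAt_orbitQ2_div_freq hk φ).fun_mul h1
  have h3 := DuffingRegion.hasDerivAt_modulusOfAction hk
  have hk' := DuffingRegion.modulusOfAction_actionOfModulus hk
  rw [← hk'] at h2
  have h4 := HasDerivAt.comp _ h2 h3
  rw [F']
  simp only [hk'] at h4
  refine (h4.congr_of_eventuallyEq ?_).deriv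
  filter_upwards [DuffingRegion.actions_mem_nhds hk] with J hJ
  obtain ⟨κ, hκ, rfl⟩ := hJ
  rw [F_actionOfModulus hκ, Function.comp_apply, DuffingRegion.modulusOfAction_actionOfModulus hκ]

theorem continuous_F_actionOfModulus (hk : k ∈ P.region.moduli) :
    Continuous (Function.uncurry (P.F (P.region.actionOfModulus k))) := by
  have h1 := DuffingRegion.continuous_orbitQ1 hk
  have h2 := DuffingRegion.continuous_orbitQ2 hk
  have : Function.uncurry (P.F (P.region.actionOfModulus k)) = fun p =>
      P.region.orbitQ2 k p.1 / P.region.freq k *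
        P.g2 (P.region.orbitQ1 k p.1) (P.region.orbitQ2 k p.1) p.2 :=
    funext fun p => F_actionOfModulus hk p.1 p.2
  rw [this]
  simp only [g2]
  fun_prop

theorem continuous_G_actionOfModulus (hk : k ∈ P.region.moduli) :
    Continuous (Function.uncurry (P.G (P.region.actionOfModulus k))) := by
  have h1 := DuffingRegion.continuous_orbitQ1 hk
  have h2 := DuffingRegion.continuous_orbitQ2 hk
  have h3 := DuffingRegion.continuous_dQ1 hk
  have : Function.uncurry (P.G (P.region.actionOfModulus k)) = fun p =>
      -(P.region.dQ1 k p.1 * (deriv P.region.energy k / P.region.freq k)⁻¹) *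
        P.g2 (P.region.orbitQ1 k p.1) (P.region.orbitQ2 k p.1) p.2 :=
    funext fun p => G_actionOfModulus hk p.1 p.2
  rw [this]
  simp only [g2]
  fun_prop

theorem continuous_F'_actionOfModulus (hk : k ∈ P.region.moduli) :
    Continuous (Function.uncurry (P.F' (P.region.actionOfModulus k))) := by
  have h1 := DuffingRegion.continuous_orbitQ1 hk
  have h2 := DuffingRegion.continuous_orbitQ2 hk
  have h3 := DuffingRegion.continuous_dQ1 hk
  have h4 := DuffingRegion.continuous_dQ2 hk
  have := funext fun p : ℝ × ℝ => F'_actionOfModulus hk p.1 p.2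
  rw [Function.uncurry_def, this]
  simp only [g2]
  fun_prop

theorem hasDerivAt_g2_orbit (hk : k ∈ P.region.moduli) (φ θ : ℝ) :
    HasDerivAt (fun φ => P.g2 (P.region.orbitQ1 k φ) (P.region.orbitQ2 k φ) θ)
      (P.η * Real.cos θ * (P.region.orbitQ2 k φ / P.region.freq k) - P.δ *
        ((P.region.orbitQ1 k φ - P.region.orbitQ1 k φ ^ 3) / P.region.freq k)) φ :=
  (((DuffingRegion.hasDerivAt_orbitQ1 hk φ).const_mul _).add_const _).sub
    ((DuffingRegion.hasDerivAt_orbitQ2 hk φ).const_mul _)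

/-- The divergence of the perturbation is the same in the variables `(I, φ)` and `(q₁, q₂)`. -/
theorem hasDerivAt_G_angle (hk : k ∈ P.region.moduli) (φ θ : ℝ) :
    HasDerivAt (fun φ => P.G (P.region.actionOfModulus k) φ θ)
      (-P.δ - P.F' (P.region.actionOfModulus k) φ θ) φ := by
  rw [funext fun φ => G_actionOfModulus hk φ θ, F'_actionOfModulus hk]
  refine (((DuffingRegion.hasDerivAt_dQ1_angle hk φ).mul_const _).fun_neg.fun_mul
    (hasDerivAt_g2_orbit hk φ θ)).congr_deriv ?_
  have hω := (DuffingRegion.freq_pos hk).ne'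
  have he := DuffingRegion.deriv_energy_ne_zero hk
  have hE := DuffingRegion.deriv_energy_eq hk φ
  field_simp
  -- The determinant identity cancels the factor `(dI/dk)⁻¹` in the `δ` terms; all other terms
  -- cancel in pairs.
  rw [hE]
  ring

/-- The derivative of `𝔉` with respect to the angle. -/
noncomputable def dF (P : DuffingResonance) (k φ θ : ℝ) : ℝ :=
  (P.region.orbitQ1 k φ - P.region.orbitQ1 k φ ^ 3) / P.region.freq k / P.region.freq k *
      P.g2 (P.region.orbitQ1 k φ) (P.region.orbitQ2 k φ) θ +
    P.region.orbitQ2 k φ / P.region.freq k *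
      (P.η * Real.cos θ * (P.region.orbitQ2 k φ / P.region.freq k) - P.δ *
        ((P.region.orbitQ1 k φ - P.region.orbitQ1 k φ ^ 3) / P.region.freq k))

theorem hasDerivAt_F_angle (hk : k ∈ P.region.moduli) (φ θ : ℝ) :
    HasDerivAt (fun φ => P.F (P.region.actionOfModulus k) φ θ) (P.dF k φ θ) φ := by
  rw [funext fun φ => F_actionOfModulus hk φ θ]
  exact ((DuffingRegion.hasDerivAt_orbitQ2 hk φ).div_const _).fun_mul (hasDerivAt_g2_orbit hk φ θ)

theorem continuous_dF (hk : k ∈ P.region.moduli) : Continuous (Function.uncurry (P.dF k)) := by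
  have h1 := DuffingRegion.continuous_orbitQ1 hk
  have h2 := DuffingRegion.continuous_orbitQ2 hk
  simp only [Function.uncurry_def, dF, g2]
  fun_prop

theorem continuous_phase : Continuous (Function.uncurry P.phase) := by
  simp only [Function.uncurry_def, phase]
  fun_prop

theorem continuous_comp_phase {f : ℝ → ℝ → ℝ} (hf : Continuous (Function.uncurry f)) :
    Continuous (Function.uncurry fun ψ θ => f (P.phase ψ θ) θ) :=
  hf.comp (continuous_phase.prodMk continuous_snd)

theorem hasDerivAt_comp_phase {f f' : ℝ → ℝ → ℝ}
    (hf : ∀ φ θ, HasDerivAt (fun φ => f φ θ) (f' φ θ) φ) (ψ θ : ℝ) :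
    HasDerivAt (fun ψ => f (P.phase ψ θ) θ) (f' (P.phase ψ θ) θ) ψ := by
  have h := HasDerivAt.comp_add_const ψ (P.n / P.m * θ) (hf (P.phase ψ θ) θ)
  exact h

theorem continuous_slice {f : ℝ → ℝ → ℝ} (hf : Continuous (Function.uncurry f)) (ψ : ℝ) :
    Continuous (f ψ) := hf.comp (continuous_const.prodMk continuous_id)

/-! ## The averaged perturbation -/

theorem continuous_F_phase (hk : k ∈ P.region.moduli) (hI : P.Ir = P.region.actionOfModulus k) :
    Continuous (Function.uncurry fun ψ θ => P.F P.Ir (P.phase ψ θ) θ) := by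
  rw [hI]; exact continuous_comp_phase (continuous_F_actionOfModulus hk)

theorem hasDerivAt_Favg (hk : k ∈ P.region.moduli) (hI : P.Ir = P.region.actionOfModulus k)
    (ψ : ℝ) :
    HasDerivAt P.Favg (P.thetaAvg fun θ => P.dF k (P.phase ψ θ) θ) ψ := by
  refine hasDerivAt_thetaAvg (f := fun ψ θ => P.F P.Ir (P.phase ψ θ) θ)
    (f' := fun ψ θ => P.dF k (P.phase ψ θ) θ) ?_ ?_ ?_ ψ
  · exact continuous_slice (continuous_F_phase hk hI)
  · exact continuous_comp_phase (continuous_dF hk)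
  · rw [hI]; exact hasDerivAt_comp_phase (hasDerivAt_F_angle hk)

theorem continuous_Favg (hk : k ∈ P.region.moduli) (hI : P.Ir = P.region.actionOfModulus k) :
    Continuous P.Favg :=
  continuous_iff_continuousAt.2 fun ψ => (hasDerivAt_Favg hk hI ψ).continuousAt

theorem Ir_pos (hk : k ∈ P.region.moduli) (hI : P.Ir = P.region.actionOfModulus k) : 0 < P.Ir := by
  rw [hI]; exact DuffingRegion.actionOfModulus_pos hk

/-- Damping contributes `-δ` times the mean of `q₂²/ω`, which is the action. Both forcing terms
carry the factor `cos θ` and give one harmonic. -/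
theorem exists_Favg_eq (hm : 0 < P.m) (hn : 0 < P.n) (hk : k ∈ P.region.moduli)
    (hI : P.Ir = P.region.actionOfModulus k) :
    ∃ A B : ℝ, ∀ ψ, P.Favg ψ = -(P.δ * P.Ir) +
      (A * Real.cos (P.m / P.n * ψ) + B * Real.sin (P.m / P.n * ψ)) := by
  have c1 := DuffingRegion.continuous_orbitQ1 hk
  have c2 := DuffingRegion.continuous_orbitQ2 hk
  obtain ⟨A, B, hAB⟩ := exists_thetaAvg_mul_cos hm hn
    (u := fun φ => P.region.orbitQ2 k φ / P.region.freq k * (P.η * P.region.orbitQ1 k φ + P.α))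
    (by fun_prop) (fun φ => by
      simp only [DuffingRegion.periodic_orbitQ1 hk φ, DuffingRegion.periodic_orbitQ2 hk φ])
  refine ⟨A, B, fun ψ => ?_⟩
  have c3 : Continuous fun θ => P.phase ψ θ := continuous_slice continuous_phase ψ
  have hF : (fun θ => P.F P.Ir (P.phase ψ θ) θ) = fun θ =>
      -P.δ * (fun φ => P.region.orbitQ2 k φ ^ 2 / P.region.freq k) (P.phase ψ θ) +
      (fun φ => P.region.orbitQ2 k φ / P.region.freq k * (P.η * P.region.orbitQ1 k φ + P.α))
        (P.phase ψ θ) * Real.cos θ := by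
    funext θ
    rw [hI, F_actionOfModulus hk, g2]
    ring
  rw [Favg, hF, thetaAvg_add (by fun_prop) (by fun_prop), hAB, thetaAvg_const_mul,
    thetaAvg_comp_phase hm hn (u := fun φ => P.region.orbitQ2 k φ ^ 2 / P.region.freq k)
      (by fun_prop) (fun φ => by simp only [DuffingRegion.periodic_orbitQ2 hk φ]),
    ← DuffingRegion.actionOfModulus_eq hk, ← hI]
  ring

theorem thetaAvg_dActionDq2_sq (hm : 0 < P.m) (hn : 0 < P.n) (hk : k ∈ P.region.moduli)
    (hI : P.Ir = P.region.actionOfModulus k) (ψ : ℝ) :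
    P.thetaAvg (fun θ => P.region.dActionDq2 P.Ir (P.phase ψ θ) ^ 2) = P.Ir / P.Ωr := by
  have c2 := DuffingRegion.continuous_orbitQ2 hk
  have hω := (DuffingRegion.freq_pos hk).ne'
  have h1 : (fun θ => P.region.dActionDq2 P.Ir (P.phase ψ θ) ^ 2) = fun θ =>
      1 / P.region.freq k *
        (fun φ => P.region.orbitQ2 k φ ^ 2 / P.region.freq k) (P.phase ψ θ) := by
    funext θ
    rw [hI, DuffingRegion.dActionDq2_actionOfModulus hk]
    field_simp
  have hΩ : P.Ωr = P.region.freq k := by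
    rw [Ωr, hI, DuffingRegion.Ω, DuffingRegion.modulusOfAction_actionOfModulus hk]
  rw [h1, thetaAvg_const_mul,
    thetaAvg_comp_phase hm hn (u := fun φ => P.region.orbitQ2 k φ ^ 2 / P.region.freq k)
      (by fun_prop) (fun φ => by simp only [DuffingRegion.periodic_orbitQ2 hk φ]),
    ← DuffingRegion.actionOfModulus_eq hk, ← hI, hΩ]
  ring

/-- The derivative of `⟨𝔉(ψ)⟩`. -/
noncomputable def dFavg (P : DuffingResonance) (k ψ : ℝ) : ℝ :=
  P.thetaAvg fun θ => P.dF k (P.phase ψ θ) θ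

theorem continuous_dFavg (hk : k ∈ P.region.moduli) : Continuous (P.dFavg k) :=
  continuous_thetaAvg (continuous_comp_phase (continuous_dF hk))

/-- The derivative of `𝒜₁(ψ, θ)` with respect to `ψ`. -/
noncomputable def dA1 (P : DuffingResonance) (k ψ θ : ℝ) : ℝ :=
  1 / P.ν * ∫ s in (0 : ℝ)..θ, (P.dF k (P.phase ψ s) s - P.dFavg k ψ)

theorem continuous_A1_integrand (hk : k ∈ P.region.moduli)
    (hI : P.Ir = P.region.actionOfModulus k) :
    Continuous (Function.uncurry fun ψ s => P.F P.Ir (P.phase ψ s) s - P.Favg ψ) :=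
  (continuous_F_phase hk hI).sub ((continuous_Favg hk hI).comp continuous_fst)

theorem continuous_dA1_integrand (hk : k ∈ P.region.moduli) :
    Continuous (Function.uncurry fun ψ s => P.dF k (P.phase ψ s) s - P.dFavg k ψ) :=
  (continuous_comp_phase (continuous_dF hk)).sub ((continuous_dFavg hk).comp continuous_fst)

theorem continuous_intervalIntegral_uncurry {f : ℝ → ℝ → ℝ} (hf : Continuous (Function.uncurry f)) :
    Continuous (Function.uncurry fun ψ θ => ∫ s in (0 : ℝ)..θ, f ψ s) := by
  have := continuousOn_intervalIntegral_strip (U := Set.univ) hf.continuousOn 0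
  rwa [Set.univ_prod_univ, continuousOn_univ] at this

theorem continuous_A1 (hk : k ∈ P.region.moduli) (hI : P.Ir = P.region.actionOfModulus k) :
    Continuous (Function.uncurry P.A1) :=
  continuous_const.mul (continuous_intervalIntegral_uncurry (continuous_A1_integrand hk hI))

theorem continuous_dA1 (hk : k ∈ P.region.moduli) : Continuous (Function.uncurry (P.dA1 k)) :=
  continuous_const.mul (continuous_intervalIntegral_uncurry (continuous_dA1_integrand hk))

theorem hasDerivAt_A1 (hk : k ∈ P.region.moduli) (hI : P.Ir = P.region.actionOfModulus k)
    (ψ θ : ℝ) : HasDerivAt (fun ψ => P.A1 ψ θ) (P.dA1 k ψ θ) ψ := by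
  refine (hasDerivAt_intervalIntegral_of_continuousOn isOpen_univ
    (f := fun ψ s => P.F P.Ir (P.phase ψ s) s - P.Favg ψ)
    (fun ψ _ => continuous_slice (continuous_A1_integrand hk hI) ψ)
    (continuous_dA1_integrand hk).continuousOn (fun ψ _ s => ?_) 0 θ (Set.mem_univ ψ)).const_mul _
  refine HasDerivAt.fun_sub ?_ (hasDerivAt_Favg hk hI ψ)
  rw [hI]
  exact hasDerivAt_comp_phase (hasDerivAt_F_angle hk) ψ s

/-- `𝒜₁` is a primitive of `(𝔉 - ⟨𝔉⟩)/ν`, so `𝒜₁ (𝔉 - ⟨𝔉⟩)` is the derivative of a multiple of the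
square of that primitive and averages to zero. -/
theorem thetaAvg_A1_mul_F (hm : 0 < P.m) (hk : k ∈ P.region.moduli)
    (hI : P.Ir = P.region.actionOfModulus k) (ψ : ℝ) :
    P.thetaAvg (fun θ => P.A1 ψ θ * P.F P.Ir (P.phase ψ θ) θ) = P.Favg ψ * P.thetaAvg (P.A1 ψ) := by
  have hm' : (0 : ℝ) < P.m := by exact_mod_cast hm
  have hπ := Real.pi_pos
  have c1 := continuous_slice (continuous_A1_integrand hk hI) ψ
  have cF := continuous_slice (continuous_F_phase hk hI) ψ
  have cA := continuous_slice (continuous_A1 hk hI) ψ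
  set S : ℝ → ℝ := fun θ => ∫ s in (0 : ℝ)..θ, (P.F P.Ir (P.phase ψ s) s - P.Favg ψ) with hS
  have hS' : ∀ θ, HasDerivAt S (P.F P.Ir (P.phase ψ θ) θ - P.Favg ψ) θ := hasDerivAt_primitive c1
  have hA : ∀ θ, P.A1 ψ θ = 1 / P.ν * S θ := fun _ => rfl
  -- Subtracting the mean is what makes the primitive return to zero.
  have hend : S (2 * P.m * Real.pi) = 0 := by
    have h1 : S (2 * P.m * Real.pi) = (∫ θ in (0 : ℝ)..(2 * P.m * Real.pi),
        P.F P.Ir (P.phase ψ θ) θ) - 2 * P.m * Real.pi * P.Favg ψ := by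
      rw [hS]
      simp only
      rw [intervalIntegral.integral_sub (cF.intervalIntegrable _ _)
        (continuous_const.intervalIntegrable _ _), intervalIntegral.integral_const]
      simp
    rw [h1, Favg, thetaAvg]
    field_simp
    ring
  have h0 : S 0 = 0 := by simp [hS]
  have hZ : P.thetaAvg (fun θ => P.A1 ψ θ * (P.F P.Ir (P.phase ψ θ) θ - P.Favg ψ)) = 0 := by
    have hd : ∀ θ, HasDerivAt (fun θ => 1 / P.ν * (S θ ^ 2 / 2))
        (P.A1 ψ θ * (P.F P.Ir (P.phase ψ θ) θ - P.Favg ψ)) θ := by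
      intro θ
      refine ((((hS' θ).fun_pow 2).div_const 2).const_mul (1 / P.ν)).congr_deriv ?_
      rw [hA]
      push_cast
      ring
    rw [thetaAvg, intervalIntegral.integral_eq_sub_of_hasDerivAt (fun θ _ => hd θ)
      ((cA.mul c1).intervalIntegrable _ _), hend, h0, sub_self, mul_zero]
  have h2 : (fun θ => P.A1 ψ θ * P.F P.Ir (P.phase ψ θ) θ) = fun θ =>
      P.A1 ψ θ * (P.F P.Ir (P.phase ψ θ) θ - P.Favg ψ) + P.Favg ψ * P.A1 ψ θ := by
    funext θ; ring
  rw [h2, thetaAvg_add (by fun_prop) (by fun_prop), hZ, zero_add, thetaAvg_const_mul]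

/-! ## The averaged system -/

theorem hasDerivAt_pendulumH_snd (ψ h : ℝ) :
    HasDerivAt (fun y => P.pendulumH ψ y) (P.Ωr' * h) h := by
  have := (((hasDerivAt_id h).fun_pow 2).const_mul (1 / 2 * P.Ωr')).sub_const
    (∫ s in (0 : ℝ)..ψ, P.Favg s)
  refine this.congr_deriv ?_
  simp
  ring

theorem hasDerivAt_pendulumH_fst (hF : Continuous P.Favg) (ψ h : ℝ) :
    HasDerivAt (fun x => P.pendulumH x h) (-P.Favg ψ) ψ :=
  (hasDerivAt_primitive hF ψ).const_sub _

theorem isPendulumSolution_iff (hF : Continuous P.Favg) {ψ h : ℝ → ℝ} :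
    P.IsPendulumSolution ψ h ↔
      ∀ t, HasDerivAt ψ (P.Ωr' * h t) t ∧ HasDerivAt h (P.Favg (ψ t)) t := by
  simp only [IsPendulumSolution, (hasDerivAt_pendulumH_snd _ _).deriv,
    (hasDerivAt_pendulumH_fst hF _ _).deriv, neg_neg]

/-- On a periodic orbit the derivative of `h z(ψ)` has average zero. -/
theorem integral_transport_eq_zero (hF : Continuous P.Favg) {ψ h : ℝ → ℝ} {T : ℝ}
    (hs : P.IsPendulumSolution ψ h) (hψ : Function.Periodic ψ T) (hh : Function.Periodic h T)
    {z z' : ℝ → ℝ} (hz : ∀ x, HasDerivAt z (z' x) x) (hz' : Continuous z') :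
    ∫ t in (0 : ℝ)..T, (P.Favg (ψ t) * z (ψ t) + P.Ωr' * h t ^ 2 * z' (ψ t)) = 0 := by
  rw [isPendulumSolution_iff hF] at hs
  have c1 : Continuous ψ := continuous_iff_continuousAt.2 fun t => (hs t).1.continuousAt
  have c2 : Continuous h := continuous_iff_continuousAt.2 fun t => (hs t).2.continuousAt
  have c3 : Continuous z := continuous_iff_continuousAt.2 fun t => (hz t).continuousAt
  have hd : ∀ t, HasDerivAt (fun t => h t * z (ψ t))
      (P.Favg (ψ t) * z (ψ t) + P.Ωr' * h t ^ 2 * z' (ψ t)) t := by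
    intro t
    refine ((hs t).2.fun_mul ((hz (ψ t)).comp t (hs t).1)).congr_deriv ?_
    simp only [Function.comp_apply]
    ring
  rw [intervalIntegral.integral_eq_sub_of_hasDerivAt (fun t _ => hd t)
    (Continuous.intervalIntegrable (by fun_prop) _ _)]
  have e1 := hψ 0
  have e2 := hh 0
  rw [zero_add] at e1 e2
  rw [e1, e2, sub_self]

/-- Since `h' = ⟨𝔉⟩`, the integrand is the derivative of `h³/3`. -/
theorem integral_Favg_mul_sq_eq_zero (hF : Continuous P.Favg) {ψ h : ℝ → ℝ} {T : ℝ}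
    (hs : P.IsPendulumSolution ψ h) (hh : Function.Periodic h T) :
    ∫ t in (0 : ℝ)..T, P.Favg (ψ t) * h t ^ 2 = 0 := by
  rw [isPendulumSolution_iff hF] at hs
  have c1 : Continuous ψ := continuous_iff_continuousAt.2 fun t => (hs t).1.continuousAt
  have c2 : Continuous h := continuous_iff_continuousAt.2 fun t => (hs t).2.continuousAt
  have hd : ∀ t, HasDerivAt (fun t => h t ^ 3 / 3) (P.Favg (ψ t) * h t ^ 2) t := by
    intro t
    refine (((hs t).2.fun_pow 3).div_const 3).congr_deriv ?_
    push_cast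
    ring
  rw [intervalIntegral.integral_eq_sub_of_hasDerivAt (fun t _ => hd t)
    (Continuous.intervalIntegrable (by fun_prop) _ _)]
  have e2 := hh 0
  rw [zero_add] at e2
  rw [e2, sub_self]

/-! ### The averaged coefficients on a closed orbit -/

section Coefficients

variable {ψsk E : ℝ} {ψ h : ℝ → ℝ} {T : ℝ}

theorem B1_eq_zero (hm : 0 < P.m) (hk : k ∈ P.region.moduli)
    (hI : P.Ir = P.region.actionOfModulus k) (ho : P.IsClosedOrbit ψsk E ψ h T) :
    P.B1 ψ h T = 0 := by
  have hF := continuous_Favg hk hI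
  have h1 : ∀ x y, P.thetaAvg (fun θ => P.A1 x θ * P.F P.Ir (P.phase x θ) θ +
      P.Ωr' * y ^ 2 * deriv (fun z => P.A1 z θ) x) =
      P.Favg x * P.thetaAvg (P.A1 x) + P.Ωr' * y ^ 2 * P.thetaAvg (P.dA1 k x) := by
    intro x y
    simp only [(hasDerivAt_A1 hk hI _ _).deriv]
    have cA := continuous_slice (continuous_A1 hk hI) x
    have cA' := continuous_slice (continuous_dA1 hk) x
    have cF := continuous_slice (continuous_F_phase hk hI) x
    rw [thetaAvg_add (by fun_prop) (by fun_prop), thetaAvg_A1_mul_F hm hk hI,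
      thetaAvg_const_mul]
  have hz : ∀ x, HasDerivAt (fun x => P.thetaAvg (P.A1 x)) (P.thetaAvg (P.dA1 k x)) x :=
    hasDerivAt_thetaAvg (fun x => continuous_slice (continuous_A1 hk hI) x) (continuous_dA1 hk)
      (hasDerivAt_A1 hk hI)
  rw [B1, orbitAvg]
  simp only [h1]
  rw [integral_transport_eq_zero hF ho.solution ho.period.1.2.1 ho.period.1.2.2 hz
    (continuous_thetaAvg (continuous_dA1 hk)), mul_zero, mul_zero]

/-- Divergence invariance replaces `⟨𝔉'⟩` by `-δ - ⟨𝔊⟩'`. What remains besides the damping is `-(h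
⟨𝔊⟩)'` and a multiple of `(h³)'`, both of mean zero. -/
theorem B2_eq (hm : 0 < P.m) (hk : k ∈ P.region.moduli)
    (hI : P.Ir = P.region.actionOfModulus k) (ho : P.IsClosedOrbit ψsk E ψ h T) :
    P.B2 ψ h T = -P.δ * P.Ωr' * orbitAvg ψ h T (fun _ y => y ^ 2) := by
  have hF := continuous_Favg hk hI
  set g : ℝ → ℝ := fun x => P.thetaAvg fun θ => P.G P.Ir (P.phase x θ) θ with hg
  set g' : ℝ → ℝ := fun x => -P.δ - P.thetaAvg fun θ => P.F' P.Ir (P.phase x θ) θ with hg'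
  have cG : Continuous (Function.uncurry fun x θ => P.G P.Ir (P.phase x θ) θ) := by
    rw [hI]; exact continuous_comp_phase (continuous_G_actionOfModulus hk)
  have cF' : Continuous (Function.uncurry fun x θ => P.F' P.Ir (P.phase x θ) θ) := by
    rw [hI]; exact continuous_comp_phase (continuous_F'_actionOfModulus hk)
  have cg' : Continuous g' := continuous_const.sub (continuous_thetaAvg cF')
  have hz : ∀ x, HasDerivAt g (g' x) x := by
    intro x
    have h := hasDerivAt_thetaAvg (P := P) (f := fun x θ => P.G P.Ir (P.phase x θ) θ)
      (f' := fun x θ => -P.δ - P.F' P.Ir (P.phase x θ) θ)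
      (fun x => continuous_slice cG x) (continuous_const.sub cF')
      (by rw [hI]; exact hasDerivAt_comp_phase (hasDerivAt_G_angle hk)) x
    refine h.congr_deriv ?_
    have e : (fun θ => -P.δ - P.F' P.Ir (P.phase x θ) θ) =
        fun θ => -P.δ + -1 * P.F' P.Ir (P.phase x θ) θ := by
      funext θ; ring
    have c1 := continuous_slice cF' x
    rw [e, thetaAvg_add (by fun_prop) (by fun_prop),
      thetaAvg_const hm, thetaAvg_const_mul]
    simp only [hg']
    ring
  have h1 : ∀ x y, P.thetaAvg (fun θ =>
      (P.Ωr' * P.F' P.Ir (P.phase x θ) θ - P.Favg x * (1 / 2 * P.Ωr'')) * y ^ 2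
        - P.Favg x * P.G P.Ir (P.phase x θ) θ) =
      -P.δ * P.Ωr' * y ^ 2 - (P.Favg x * g x + P.Ωr' * y ^ 2 * g' x)
        - 1 / 2 * P.Ωr'' * (P.Favg x * y ^ 2) := by
    intro x y
    have e : (fun θ => (P.Ωr' * P.F' P.Ir (P.phase x θ) θ - P.Favg x * (1 / 2 * P.Ωr'')) * y ^ 2
        - P.Favg x * P.G P.Ir (P.phase x θ) θ) = fun θ =>
        (P.Ωr' * y ^ 2 * P.F' P.Ir (P.phase x θ) θ + -(P.Favg x * (1 / 2 * P.Ωr'')) * y ^ 2) +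
          -P.Favg x * P.G P.Ir (P.phase x θ) θ := by
      funext θ; ring
    have c1 := continuous_slice cF' x
    have c2 := continuous_slice cG x
    rw [e, thetaAvg_add (by fun_prop) (by fun_prop), thetaAvg_add (by fun_prop) (by fun_prop),
      thetaAvg_const hm, thetaAvg_const_mul, thetaAvg_const_mul]
    simp only [hg, hg']
    ring
  have hs := (isPendulumSolution_iff hF).1 ho.solution
  have c1 : Continuous ψ := continuous_iff_continuousAt.2 fun t => (hs t).1.continuousAt
  have c2 : Continuous h := continuous_iff_continuousAt.2 fun t => (hs t).2.continuousAt
  have c3 : Continuous g := continuous_iff_continuousAt.2 fun t => (hz t).continuousAt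
  rw [B2, orbitAvg, orbitAvg]
  simp only [h1]
  rw [intervalIntegral.integral_sub (Continuous.intervalIntegrable (by fun_prop) _ _)
      (Continuous.intervalIntegrable (by fun_prop) _ _),
    intervalIntegral.integral_sub (Continuous.intervalIntegrable (by fun_prop) _ _)
      (Continuous.intervalIntegrable (by fun_prop) _ _),
    integral_transport_eq_zero hF ho.solution ho.period.1.2.1 ho.period.1.2.2 hz cg',
    intervalIntegral.integral_const_mul, intervalIntegral.integral_const_mul,
    integral_Favg_mul_sq_eq_zero hF ho.solution ho.period.1.2.2]
  ring

theorem Bσ_eq (hm : 0 < P.m) (hn : 0 < P.n) (hk : k ∈ P.region.moduli)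
    (hI : P.Ir = P.region.actionOfModulus k) (ho : P.IsClosedOrbit ψsk E ψ h T) :
    P.Bσ ψ h T = 1 / 2 * P.σ ^ 2 * (P.Ωr' * P.Ir / P.Ωr) := by
  have hT : T ≠ 0 := ho.period.1.1.ne'
  simp only [Bσ, orbitAvg, thetaAvg_dActionDq2_sq hm hn hk hI, intervalIntegral.integral_const,
    smul_eq_mul, sub_zero]
  field_simp

theorem Ξ_eq (hm : 0 < P.m) (hn : 0 < P.n) (hk : k ∈ P.region.moduli)
    (hI : P.Ir = P.region.actionOfModulus k) :
    P.Ξ ψ h T = P.σ ^ 2 * P.Ωr' ^ 2 * P.Ir / P.Ωr * orbitAvg ψ h T (fun _ y => y ^ 2) := by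
  simp only [Ξ, orbitAvg, mul_pow, thetaAvg_const_mul, thetaAvg_dActionDq2_sq hm hn hk hI,
    intervalIntegral.integral_mul_const]
  ring

end Coefficients

end DuffingResonance

/-! ## Closed orbits of a particle in a potential well -/

section PotentialWell

variable {W W' : ℝ → ℝ} {a b e : ℝ}

/-- A function with simple zeros at the ends of an interval, positive inside, is
`(x - a) (b - x) Q(x)` with `Q` positive on the closed interval. -/
theorem exists_factor_of_simple_zeros {f f' : ℝ → ℝ} (hab : a < b)
    (hf : ∀ x, HasDerivAt f (f' x) x) (ha : f a = 0) (hb : f b = 0)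
    (hpos : ∀ x ∈ Set.Ioo a b, 0 < f x) (ha' : f' a ≠ 0) (hb' : f' b ≠ 0) :
    ∃ Q : ℝ → ℝ, Continuous Q ∧ (∀ x ∈ Set.Icc a b, 0 < Q x) ∧
      (∀ x ∈ Set.Ioo a b, DifferentiableAt ℝ Q x) ∧ ∀ x, f x = (x - a) * (b - x) * Q x := by
  set g := dslope f a with hg
  have hfc : ∀ x, ContinuousAt f x := fun x => (hf x).continuousAt
  have hgc : ∀ x, ContinuousAt g x := by
    intro x
    rcases eq_or_ne x a with rfl | hx
    · exact continuousAt_dslope_same.2 (hf x).differentiableAt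
    · exact (continuousAt_dslope_of_ne hx).2 (hfc x)
  have hgd : ∀ x, x ≠ a → DifferentiableAt ℝ g x :=
    fun x hx => (differentiableAt_dslope_of_ne hx).2 (hf x).differentiableAt
  have hfg : ∀ x, f x = (x - a) * g x := by
    intro x
    have := sub_smul_dslope f a x
    rw [ha, sub_zero, smul_eq_mul] at this
    exact this.symm
  have hgb : g b = 0 := by
    have := hfg b
    rw [hb, eq_comm, mul_eq_zero] at this
    exact this.resolve_left (sub_pos.2 hab).ne'
  have hga : g a = f' a := by rw [hg, dslope_same, (hf a).deriv]
  set q := dslope g b with hq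
  have hgq : ∀ x, g x = (x - b) * q x := by
    intro x
    have := sub_smul_dslope g b x
    rw [hgb, sub_zero, smul_eq_mul] at this
    exact this.symm
  -- The second quotient is continuous at `b` because the first is differentiable away from `a`; one
  -- derivative of `f` therefore suffices.
  have hqc : Continuous q := by
    refine continuous_iff_continuousAt.2 fun x => ?_
    rcases eq_or_ne x b with rfl | hx
    · exact continuousAt_dslope_same.2 (hgd x hab.ne')
    · exact (continuousAt_dslope_of_ne hx).2 (hgc x)
  have hfac : ∀ x, f x = (x - a) * (b - x) * -q x := by
    intro x; rw [hfg, hgq]; ring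
  have hin : ∀ x ∈ Set.Ioo a b, 0 < -q x := by
    intro x hx
    have h1 := hpos x hx
    rw [hfac] at h1
    exact pos_of_mul_pos_right h1 (mul_nonneg (sub_nonneg.2 hx.1.le) (sub_nonneg.2 hx.2.le))
  have hcl : ∀ x ∈ Set.Icc a b, 0 ≤ -q x := by
    have h1 : closure (Set.Ioo a b) ⊆ {x | 0 ≤ -q x} :=
      closure_minimal (fun x hx => (hin x hx).le) (isClosed_le continuous_const hqc.neg)
    rwa [closure_Ioo hab.ne] at h1
  have hqa : q a ≠ 0 := by
    intro h
    rw [hgq, h, mul_zero] at hga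
    exact ha' hga.symm
  -- If `q b = 0` then `g` has zero derivative at `b`, and so has `f = (x - a) g`.
  have hqb : q b ≠ 0 := by
    intro h
    have h1 : HasDerivAt g 0 b := by
      have := (hgd b hab.ne').hasDerivAt
      rwa [← dslope_same, ← hq, h] at this
    have h2 := ((hasDerivAt_id b).sub_const a).fun_mul h1
    have h3 : (fun x => (id x - a) * g x) = f := funext fun x => (hfg x).symm
    rw [h3] at h2
    have := h2.unique (hf b)
    rw [hgb] at this
    simp at this
    exact hb' this.symm
  refine ⟨fun x => -q x, hqc.neg, fun x hx => ?_, fun x hx => ?_, hfac⟩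
  · rcases eq_or_lt_of_le hx.1 with rfl | h1
    · exact lt_of_le_of_ne (hcl _ hx) (neg_ne_zero.2 hqa).symm
    · rcases eq_or_lt_of_le hx.2 with rfl | h2
      · exact lt_of_le_of_ne (hcl _ hx) (neg_ne_zero.2 hqb).symm
      · exact hin x ⟨h1, h2⟩
  · exact ((differentiableAt_dslope_of_ne hx.2.ne).2 (hgd x hx.1.ne')).neg

/-- In a potential well with nondegenerate turning points `a < b` at energy `e` there is a
periodic motion of energy `e`, which sweeps the interval `[a, b]`. -/
theorem exists_periodic_motion (hab : a < b) (hW : ∀ x, HasDerivAt W (W' x) x)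
    (hW' : Continuous W') (ha : W a = e) (hb : W b = e) (hlt : ∀ x ∈ Set.Ioo a b, W x < e)
    (ha' : W' a ≠ 0) (hb' : W' b ≠ 0) :
    ∃ (x v : ℝ → ℝ) (T : ℝ), (∀ t, HasDerivAt x (v t) t) ∧ (∀ t, HasDerivAt v (-W' (x t)) t) ∧
      (∀ t, v t ^ 2 / 2 + W (x t) = e) ∧ (∀ c ∈ Set.Icc a b, ∃ t, x t = c) ∧
      IsLeast {S : ℝ | 0 < S ∧ Function.Periodic x S ∧ Function.Periodic v S} T := by
  obtain ⟨Q, hQc, hQpos, hQd, hQ⟩ := exists_factor_of_simple_zeros (f := fun x => e - W x)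
    (f' := fun x => -W' x) hab (fun x => (hW x).const_sub e) (by simp [ha]) (by simp [hb])
    (fun x hx => sub_pos.2 (hlt x hx)) (neg_ne_zero.2 ha') (neg_ne_zero.2 hb')
  set ρ := (b - a) / 2 with hρ
  have hρ0 : 0 < ρ := by rw [hρ]; linarith
  -- Uniformization of the turning points: here `(x - a)(b - x) = ρ² sin² τ`, so `v² = 2 (e - W)`
  -- becomes `τ' = √(2 Q)`, positive and bounded away from zero. The time is a primitive of `1/r`,
  -- to be inverted.
  set X : ℝ → ℝ := fun τ => (a + b) / 2 - ρ * Real.cos τ with hX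
  have hXmem : ∀ τ, X τ ∈ Set.Icc a b := by
    intro τ
    have h1 := Real.cos_le_one τ
    have h2 := Real.neg_one_le_cos τ
    constructor <;> simp only [hX, hρ] <;> nlinarith
  have hXc : Continuous X := by fun_prop
  set r : ℝ → ℝ := fun τ => √(2 * Q (X τ)) with hr
  have hrpos : ∀ τ, 0 < r τ := fun τ => Real.sqrt_pos.2 (mul_pos two_pos (hQpos _ (hXmem τ)))
  have hrc : Continuous r := by fun_prop
  have hrp : Function.Periodic r (2 * Real.pi) := by
    intro τ; simp only [hr, hX, Real.cos_add_two_pi]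
  set g : ℝ → ℝ := fun τ => (r τ)⁻¹ with hg
  have hgc : Continuous g := hrc.inv₀ fun τ => (hrpos τ).ne'
  have hgp : Function.Periodic g (2 * Real.pi) := fun τ => by simp only [hg, hrp τ]
  obtain ⟨M, hM⟩ := (isCompact_Icc (a := a) (b := b)).exists_bound_of_continuousOn hQc.continuousOn
  have hMpos : 0 < M :=
    (hQpos a ⟨le_rfl, hab.le⟩).trans_le ((le_abs_self _).trans (hM a ⟨le_rfl, hab.le⟩))
  have hc : 0 < (√(2 * M))⁻¹ := by positivity
  have hcg : ∀ τ, (√(2 * M))⁻¹ ≤ g τ := by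
    intro τ
    refine inv_anti₀ (hrpos τ) (Real.sqrt_le_sqrt ?_)
    have := (le_abs_self _).trans (hM _ (hXmem τ))
    linarith
  set G : ℝ → ℝ := fun x => ∫ s in (0 : ℝ)..x, g s with hG
  set τ : ℝ → ℝ := Function.invFun G with hτ
  have hGm : StrictMono G := strictMono_primitive hgc hc hcg
  have hGτ : ∀ t, G (τ t) = t :=
    Function.rightInverse_invFun (surjective_primitive hgc hc hcg)
  have hτG : ∀ σ, τ (G σ) = σ := Function.leftInverse_invFun hGm.injective
  have hτd : ∀ t, HasDerivAt τ (r (τ t)) t := by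
    intro t
    have := hasDerivAt_invFun_primitive hgc hc hcg t
    simp only [hg, inv_inv] at this
    exact this
  have hτc : Continuous τ := continuous_iff_continuousAt.2 fun t => (hτd t).continuousAt
  have hτT : ∀ t, τ (t + G (2 * Real.pi)) = τ t + 2 * Real.pi :=
    invFun_primitive_add_period hgc hc hcg hgp
  have hG0 : G 0 = 0 := by simp [hG]
  have hτ0 : τ 0 = 0 := by
    have := hτG 0
    rwa [hG0] at this
  set x : ℝ → ℝ := fun t => X (τ t) with hx
  set v : ℝ → ℝ := fun t => ρ * Real.sin (τ t) * r (τ t) with hv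
  have hxd : ∀ t, HasDerivAt x (v t) t := by
    intro t
    refine (((hτd t).cos.const_mul ρ).const_sub ((a + b) / 2)).congr_deriv ?_
    simp only [hv]; ring
  have hxc : Continuous x := hXc.comp hτc
  have hvc : Continuous v := by fun_prop
  have hE : ∀ t, v t ^ 2 / 2 + W (x t) = e := by
    intro t
    have h1 := hQ (x t)
    have h2 : r (τ t) ^ 2 = 2 * Q (x t) :=
      Real.sq_sqrt (mul_pos two_pos (hQpos _ (hXmem _))).le
    have h3 : (x t - a) * (b - x t) = ρ ^ 2 * Real.sin (τ t) ^ 2 := by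
      simp only [hx, hX, hρ, Real.sin_sq]; ring
    rw [h3] at h1
    simp only [hv, mul_pow, h2]
    linarith
  -- `Q` need not be differentiable at `a` and `b`. Newton's equation is first derived from energy
  -- conservation where `v ≠ 0`, then extended across these countably many times by integration.
  have hcount : {t | Real.sin (τ t) = 0}.Countable := by
    have hτinj : Function.Injective τ := fun s t h => by rw [← hGτ s, h, hGτ]
    have h1 : {y : ℝ | Real.sin y = 0}.Countable := by
      refine (Set.countable_range fun n : ℤ => (n : ℝ) * Real.pi).mono fun y hy => ?_
      obtain ⟨n, hn⟩ := Real.sin_eq_zero_iff.1 hy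
      exact ⟨n, hn⟩
    exact h1.preimage hτinj
  have hvoff : ∀ t, Real.sin (τ t) ≠ 0 → HasDerivAt v (-W' (x t)) t := by
    intro t ht
    have hvt : v t ≠ 0 := mul_ne_zero (mul_ne_zero hρ0.ne' ht) (hrpos _).ne'
    have hxin : x t ∈ Set.Ioo a b := by
      have h3 : (x t - a) * (b - x t) = ρ ^ 2 * Real.sin (τ t) ^ 2 := by
        simp only [hx, hX, hρ, Real.sin_sq]; ring
      have h4 : (x t - a) * (b - x t) ≠ 0 := by
        rw [h3]; exact mul_ne_zero (pow_ne_zero 2 hρ0.ne') (pow_ne_zero 2 ht)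
      refine ⟨lt_of_le_of_ne (hXmem _).1 fun h => h4 ?_, lt_of_le_of_ne (hXmem _).2 fun h => h4 ?_⟩
      · rw [← h]; ring
      · rw [h]; ring
    have hrd : DifferentiableAt ℝ (fun t => r (τ t)) t := by
      have h1 : DifferentiableAt ℝ (fun t => 2 * Q (x t)) t :=
        ((hQd _ hxin).comp t (hxd t).differentiableAt).const_mul 2
      exact h1.sqrt (mul_pos two_pos (hQpos _ (hXmem _))).ne'
    have hvd : DifferentiableAt ℝ v t :=
      ((hτd t).differentiableAt.sin.const_mul ρ).mul hrd
    have h2 := ((hvd.hasDerivAt.fun_pow 2).div_const 2).fun_add ((hW (x t)).comp t (hxd t))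
    have h3 := h2.unique ((hasDerivAt_const t e).congr_of_eventuallyEq (Eventually.of_forall hE))
    have h4 : v t * (deriv v t + W' (x t)) = 0 := by
      rw [← h3]; push_cast; ring
    have h5 := (mul_eq_zero.1 h4).resolve_left hvt
    have h6 := hvd.hasDerivAt
    rwa [show deriv v t = -W' (x t) by linarith] at h6
  have hvd : ∀ t, HasDerivAt v (-W' (x t)) t := by
    have hwc : Continuous fun t => -W' (x t) := (hW'.comp hxc).neg
    have h1 : ∀ t, v t = (∫ s in (0 : ℝ)..t, -W' (x s)) + v 0 := by
      intro t
      have := MeasureTheory.integral_eq_of_hasDerivAt_off_countable v (fun s => -W' (x s))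
        (a := 0) (b := t) hcount hvc.continuousOn (fun s hs => hvoff s hs.2)
        (hwc.intervalIntegrable _ _)
      rw [this]; ring
    rw [funext h1]
    exact fun t => (hasDerivAt_primitive hwc t).add_const _
  refine ⟨x, v, G (2 * Real.pi), hxd, hvd, hE, ?_, ⟨?_, ?_, ?_⟩, ?_⟩
  · intro c hc
    refine ⟨G (Real.arccos (((a + b) / 2 - c) / ρ)), ?_⟩
    simp only [hx, hτG, hX]
    rw [Real.cos_arccos]
    · field_simp; ring
    · rw [le_div_iff₀ hρ0, hρ]; linarith [hc.2]
    · rw [div_le_iff₀ hρ0, hρ]; linarith [hc.1]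
  · rw [← hG0]; exact hGm Real.two_pi_pos
  · intro t; simp only [hx, hτT, hX, Real.cos_add_two_pi]
  · intro t; simp only [hv, hτT, hrp (τ t), Real.sin_add_two_pi]
  · rintro S ⟨hS, hxS, -⟩
    -- The motion starts at the extreme position `a`, attained only when `τ` is a multiple of `2π`;
    -- this excludes shorter periods.
    have h1 := hxS 0
    simp only [zero_add, hx, hX, hτ0, Real.cos_zero] at h1
    have h2 : Real.cos (τ S) = 1 := by
      apply mul_left_cancel₀ hρ0.ne'
      linarith
    obtain ⟨l, hl⟩ := (Real.cos_eq_one_iff _).1 h2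
    have h3 : 0 < τ S := by
      rw [← hGm.lt_iff_lt, hGτ, hG0]; exact hS
    have h4 : (0 : ℝ) < l := by
      rw [← hl] at h3
      exact pos_of_mul_pos_left h3 Real.two_pi_pos.le
    have h5 : (1 : ℝ) ≤ l := by
      have : 0 < l := by exact_mod_cast h4
      exact_mod_cast this
    rw [← hGτ S]
    refine hGm.monotone ?_
    rw [← hl]
    nlinarith [Real.two_pi_pos]

theorem exists_left_turning_point (hW : Continuous W) {l s : ℝ} (hls : l < s) (hl : e < W l)
    (hs : W s < e) : ∃ a, l < a ∧ a < s ∧ W a = e ∧ ∀ x, a < x → x ≤ s → W x < e := by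
  have hK : IsCompact (Set.Icc l s ∩ {x | e ≤ W x}) :=
    isCompact_Icc.inter_right (isClosed_le continuous_const hW)
  -- The turning point is the last point before `s` where the potential is at least `e`.
  obtain ⟨a, ⟨ha, hea⟩, hmax⟩ := hK.exists_isGreatest ⟨l, ⟨le_rfl, hls.le⟩, hl.le⟩
  simp only [Set.mem_ofPred_eq] at hea
  have has : a < s := lt_of_le_of_ne ha.2 fun h => by rw [h] at hea; linarith
  have hin : ∀ x, a < x → x ≤ s → W x < e := by
    intro x hx hxs
    by_contra! h
    exact absurd (hmax ⟨⟨ha.1.trans hx.le, hxs⟩, h⟩) (not_le.2 hx)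
  have hae : W a = e := by
    refine le_antisymm ?_ hea
    have h1 : closure (Set.Ioo a s) ⊆ {x | W x ≤ e} :=
      closure_minimal (fun x hx => (hin x hx.1 hx.2.le).le) (isClosed_le hW continuous_const)
    rw [closure_Ioo has.ne] at h1
    exact h1 ⟨le_rfl, has.le⟩
  exact ⟨a, lt_of_le_of_ne ha.1 fun h => by rw [h, hae] at hl; exact lt_irrefl _ hl, has, hae, hin⟩

theorem exists_turning_points (hW : Continuous W) {l s r : ℝ} (hls : l < s) (hsr : s < r)
    (hl : e < W l) (hs : W s < e) (hr : e < W r) :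
    ∃ a b, l < a ∧ a < s ∧ s < b ∧ b < r ∧ W a = e ∧ W b = e ∧ ∀ x ∈ Set.Ioo a b, W x < e := by
  obtain ⟨a, h1, h2, h3, h4⟩ := exists_left_turning_point hW hls hl hs
  obtain ⟨b, k1, k2, k3, k4⟩ := exists_left_turning_point (W := fun x => W (-x))
    (hW.comp continuous_neg) (neg_lt_neg hsr) (by simpa using hr) (by simpa using hs)
  refine ⟨a, -b, h1, h2, by linarith, by linarith, h3, k3, fun x hx => ?_⟩
  rcases le_total x s with h | h
  · exact h4 x hx.1 h
  · have := k4 (-x) (by linarith [hx.2]) (by linarith)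
    simpa using this

/-- The turning point of a homoclinic motion. -/
theorem exists_homoclinic_turning_point {x v : ℝ → ℝ} {p q t₀ : ℝ}
    (hx : ∀ t, HasDerivAt x (v t) t) (hE : ∀ t, v t ^ 2 / 2 + W (x t) = W p)
    (htop : Tendsto x atTop (𝓝 p)) (hbot : Tendsto x atBot (𝓝 p)) (hq : x t₀ = q) (hpq : p < q) :
    ∃ M, q ≤ M ∧ W M = W p ∧ ∀ c ∈ Set.Icc p M, W c ≤ W p := by
  have hc : Continuous x := continuous_iff_continuousAt.2 fun t => (hx t).continuousAt
  -- The position exceeds its limit `p` at `t₀`, so it attains a maximum; there `v = 0` and `W`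
  -- equals the total energy.
  obtain ⟨t₁, ht₁⟩ := hc.exists_forall_ge' t₀ (by
    rw [cocompact_eq_atBot_atTop, eventually_sup, hq]
    exact ⟨(hbot.eventually_lt_const hpq).mono fun _ h => h.le,
      (htop.eventually_lt_const hpq).mono fun _ h => h.le⟩)
  have hv : v t₁ = 0 :=
    IsLocalMax.hasDerivAt_eq_zero (Eventually.of_forall ht₁) (hx t₁)
  refine ⟨x t₁, hq ▸ ht₁ t₀, ?_, fun c hc' => ?_⟩
  · rw [← hE t₁, hv]; ring
  · rcases eq_or_lt_of_le hc'.1 with rfl | h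
    · exact le_rfl
    · obtain ⟨t₂, ht₂⟩ := (htop.eventually_lt_const h).exists
      -- Every position strictly above `p` and up to the maximum is visited, and the kinetic energy
      -- there is nonnegative.
      obtain ⟨t, rfl⟩ := mem_range_of_exists_le_of_exists_ge hc ⟨t₂, ht₂.le⟩ ⟨t₁, hc'.2⟩
      rw [← hE t]
      nlinarith [sq_nonneg (v t)]

end PotentialWell

/-! ## The torqued pendulum -/

section TorquedPendulum

variable {f : ℝ → ℝ} {c₀ A B μ : ℝ}

theorem integral_torque_period (hμ : 0 < μ)
    (hf : ∀ x, f x = c₀ + (A * Real.cos (μ * x) + B * Real.sin (μ * x))) :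
    ∫ s in (0 : ℝ)..(2 * Real.pi / μ), f s = c₀ * (2 * Real.pi / μ) := by
  have hd : ∀ x, HasDerivAt (fun x => c₀ * x + (A / μ * Real.sin (μ * x)
      - B / μ * Real.cos (μ * x))) (f x) x := by
    intro x
    have h1 : HasDerivAt (fun x => μ * x) μ x := by simpa using (hasDerivAt_id x).const_mul μ
    refine (((hasDerivAt_id x).const_mul c₀).fun_add
      ((h1.sin.const_mul (A / μ)).fun_sub (h1.cos.const_mul (B / μ)))).congr_deriv ?_
    rw [hf]
    field_simp
    ring
  have hc : Continuous f := by rw [funext hf]; fun_prop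
  rw [intervalIntegral.integral_eq_sub_of_hasDerivAt (fun x _ => hd x) (hc.intervalIntegrable _ _),
    mul_div_cancel₀ _ hμ.ne']
  simp

theorem periodic_torque (hμ : 0 < μ)
    (hf : ∀ x, f x = c₀ + (A * Real.cos (μ * x) + B * Real.sin (μ * x))) :
    Function.Periodic f (2 * Real.pi / μ) := by
  intro x
  rw [hf, hf, mul_add, mul_div_cancel₀ _ hμ.ne', Real.cos_add_two_pi, Real.sin_add_two_pi]

/-- Two zeros of the torque with the same slope differ by a multiple of the period. -/
theorem exists_int_of_torque_zero (hμ : 0 < μ) (hc₀ : c₀ ≠ 0)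
    (hf : ∀ x, f x = c₀ + (A * Real.cos (μ * x) + B * Real.sin (μ * x))) {x y : ℝ}
    (hx : f x = 0) (hy : f y = 0)
    (hxy : -A * Real.sin (μ * x) + B * Real.cos (μ * x) =
      -A * Real.sin (μ * y) + B * Real.cos (μ * y)) :
    ∃ l : ℤ, y = x + l * (2 * Real.pi / μ) := by
  rw [hf] at hx hy
  -- Otherwise the torque would be the nonzero constant `c₀`.
  have hAB : A ^ 2 + B ^ 2 ≠ 0 := by
    intro h
    have hA : A = 0 := by nlinarith [sq_nonneg A, sq_nonneg B]
    have hB : B = 0 := by nlinarith [sq_nonneg A, sq_nonneg B]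
    rw [hA, hB] at hx
    simp at hx
    exact hc₀ hx
  obtain ⟨l, hl⟩ := exists_int_of_cos_eq_of_sin_eq (x := μ * x) (y := μ * y)
    (by
      apply mul_left_cancel₀ hAB
      linear_combination A * (hx - hy) + B * hxy)
    (by
      apply mul_left_cancel₀ hAB
      linear_combination B * (hx - hy) - A * hxy)
  refine ⟨l, ?_⟩
  field_simp
  linarith

/-- In a potential well bounded by a saddle and a point of the same height, over which the
potential does not rise above the saddle, a center is the only equilibrium. -/
theorem eq_center_of_torque_zero (hμ : 0 < μ) (hc₀ : c₀ ≠ 0)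
    (hf : ∀ x, f x = c₀ + (A * Real.cos (μ * x) + B * Real.sin (μ * x))) {w p q l r : ℝ}
    (hw : w ≠ 0) (hp : f p = 0) (hq : f q = 0) (hpq : deriv f p * deriv f q < 0)
    (hlp : p = l ∨ p = r) (hlr : l < r) (hqlr : q ∈ Set.Ioo l r)
    (hW : w * ∫ s in (0 : ℝ)..l, f s = w * ∫ s in (0 : ℝ)..r, f s)
    (hle : ∀ c ∈ Set.Icc l r, w * ∫ s in (0 : ℝ)..c, f s ≤ w * ∫ s in (0 : ℝ)..l, f s)
    {c : ℝ} (hc : c ∈ Set.Ioo l r) (hfc : f c = 0) : c = q := by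
  have hcont : Continuous f := by rw [funext hf]; fun_prop
  have hshift : ∀ x, ∫ s in (0 : ℝ)..(x + 2 * Real.pi / μ), f s =
      (∫ s in (0 : ℝ)..x, f s) + c₀ * (2 * Real.pi / μ) := by
    intro x
    rw [primitive_add_period hcont (periodic_torque hμ hf), integral_torque_period hμ hf]
  have hppos : 0 < 2 * Real.pi / μ := by have := Real.pi_pos; positivity
  set P := 2 * Real.pi / μ with hP
  -- A period changes the potential by `w c₀ P ≠ 0`. In a longer interval both `l + P` and `r - P`
  -- would lie below the common end height, forcing this change to be both nonpositive and
  -- nonnegative.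
  have hlen : r - l < P := by
    by_contra! h
    have h1 := hle (l + P) ⟨by linarith, by linarith⟩
    have h2 := hle (r - P) ⟨by linarith, by linarith⟩
    have h3 := hshift (r - P)
    rw [sub_add_cancel] at h3
    rw [hshift] at h1
    rw [h3] at hW
    have h4 : w * (c₀ * P) = 0 := by nlinarith
    exact mul_ne_zero hw (mul_ne_zero hc₀ hppos.ne') h4
  have hd : ∀ x, deriv f x = μ * (-A * Real.sin (μ * x) + B * Real.cos (μ * x)) := by
    intro x
    have h1 : HasDerivAt (fun x => μ * x) μ x := by simpa using (hasDerivAt_id x).const_mul μ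
    have h2 := ((h1.cos.const_mul A).fun_add (h1.sin.const_mul B)).const_add c₀
    rw [funext hf, h2.deriv]
    ring
  -- All zeros share the same squared slope, so a zero has the slope of `q` or that of `p`; being
  -- less than a period away, it is then `q` or `p`, and `p` is an endpoint.
  have hsq : ∀ x, f x = 0 → (-A * Real.sin (μ * x) + B * Real.cos (μ * x)) ^ 2 =
      A ^ 2 + B ^ 2 - c₀ ^ 2 := by
    intro x hx
    rw [hf] at hx
    have h1 := Real.sin_sq_add_cos_sq (μ * x)
    have h2 : A * Real.cos (μ * x) + B * Real.sin (μ * x) = -c₀ := by linarith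
    have h3 : (A * Real.cos (μ * x) + B * Real.sin (μ * x)) ^ 2 = c₀ ^ 2 := by rw [h2]; ring
    linear_combination (A ^ 2 + B ^ 2) * h1 - h3
  have small : ∀ {x y : ℝ} {j : ℤ}, x ∈ Set.Icc l r → y ∈ Set.Icc l r → y = x + j * P → y = x := by
    intro x y j hx hy h
    have j1 : (j : ℝ) < 1 := by
      by_contra! hj
      nlinarith [hx.1, hy.2]
    have j2 : (-1 : ℝ) < j := by
      by_contra! hj
      nlinarith [hx.2, hy.1]
    have j0 : j = 0 := by
      have : j < 1 := by exact_mod_cast j1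
      have : -1 < j := by exact_mod_cast j2
      omega
    rw [h, j0]; simp
  have hcI := Set.Ioo_subset_Icc_self hc
  have hqI := Set.Ioo_subset_Icc_self hqlr
  rw [hd, hd] at hpq
  have h1 := hsq p hp
  have h2 := hsq q hq
  have h3 := hsq c hfc
  generalize hsp : -A * Real.sin (μ * p) + B * Real.cos (μ * p) = sp at *
  generalize hsq' : -A * Real.sin (μ * q) + B * Real.cos (μ * q) = sq at *
  generalize hsc : -A * Real.sin (μ * c) + B * Real.cos (μ * c) = sc at *
  have hneg : sp * sq < 0 := by
    by_contra! h
    nlinarith [mul_nonneg (mul_pos hμ hμ).le h]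
  have hopp : sp = -sq := by
    rcases sq_eq_sq_iff_eq_or_eq_neg.1 (h1.trans h2.symm) with h | h
    · rw [h] at hneg; nlinarith [mul_self_nonneg sq]
    · exact h
  rcases sq_eq_sq_iff_eq_or_eq_neg.1 (h3.trans h2.symm) with h | h
  · obtain ⟨j, hj⟩ := exists_int_of_torque_zero hμ hc₀ hf hq hfc (by rw [hsq', hsc, h])
    exact small hqI hcI hj
  · obtain ⟨j, hj⟩ := exists_int_of_torque_zero hμ hc₀ hf hp hfc (by rw [hsp, hsc, h, hopp])
    have hpI : p ∈ Set.Icc l r := by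
      rcases hlp with rfl | rfl
      · exact ⟨le_rfl, hlr.le⟩
      · exact ⟨hlr.le, le_rfl⟩
    have := small hpI hcI hj
    rcases hlp with h' | h'
    · rw [this, h'] at hc; exact absurd hc.1 (lt_irrefl _)
    · rw [this, h'] at hc; exact absurd hc.2 (lt_irrefl _)

end TorquedPendulum

/-! ### Existence of the closed orbit -/

namespace DuffingResonance

variable {P : DuffingResonance} {k : ℝ}

theorem exists_isClosedOrbit (hm : 0 < P.m) (hn : 0 < P.n) (hδ : 0 < P.δ)
    (hk : k ∈ P.region.moduli) (hI : P.Ir = P.region.actionOfModulus k)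
    {ψsd ψsk : ℝ} (hpair : P.IsSaddleCenterPair ψsd ψsk) {E : ℝ}
    (hE : E ∈ Set.Ioo (min (P.pendulumH ψsk 0) (P.pendulumH ψsd 0))
      (max (P.pendulumH ψsk 0) (P.pendulumH ψsd 0))) :
    ∃ (ψ h : ℝ → ℝ) (T : ℝ), P.IsClosedOrbit ψsk E ψ h T := by
  have hm' : (0 : ℝ) < P.m := by exact_mod_cast hm
  have hn' : (0 : ℝ) < P.n := by exact_mod_cast hn
  have hF := continuous_Favg hk hI
  obtain ⟨A, B, hAB⟩ := exists_Favg_eq hm hn hk hI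
  have hc₀ : -(P.δ * P.Ir) ≠ 0 := (neg_neg_of_pos (mul_pos hδ (Ir_pos hk hI))).ne
  have hΩ : P.Ωr' ≠ 0 := by
    intro h
    have := hpair.saddle_type
    rw [h, zero_mul] at this
    exact lt_irrefl _ this
  set W : ℝ → ℝ := fun x => -P.Ωr' * ∫ s in (0 : ℝ)..x, P.Favg s with hWdef
  have hW : ∀ x, HasDerivAt W (-P.Ωr' * P.Favg x) x := fun x =>
    (hasDerivAt_primitive hF x).const_mul _
  have hWc : Continuous W := continuous_iff_continuousAt.2 fun x => (hW x).continuousAt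
  -- Multiplication by `Ω'_r` puts the Hamiltonian in the form kinetic plus potential energy with
  -- velocity `Ω'_r h`, whatever the sign of `Ω'_r`.
  have hHW : ∀ ψ h, P.Ωr' * P.pendulumH ψ h = (P.Ωr' * h) ^ 2 / 2 + W ψ := by
    intro ψ h
    simp only [pendulumH, hWdef]
    ring
  have hHW0 : ∀ ψ, P.Ωr' * P.pendulumH ψ 0 = W ψ := by
    intro ψ
    rw [hHW]; ring
  obtain ⟨ψ, h, hsol, ht1, ht2, hb1, hb2, t₀, ht₀⟩ := hpair.homoclinic
  have hs := (isPendulumSolution_iff hF).1 hsol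
  -- The conserved energy is identified by its limit at the saddle.
  have hcons : ∀ t, (P.Ωr' * h t) ^ 2 / 2 + W (ψ t) = W ψsd := by
    have hd : ∀ t, HasDerivAt (fun t => (P.Ωr' * h t) ^ 2 / 2 + W (ψ t)) 0 t := by
      intro t
      refine (((((hs t).2.const_mul P.Ωr').fun_pow 2).div_const 2).fun_add
        ((hW (ψ t)).comp t (hs t).1)).congr_deriv ?_
      push_cast
      ring
    have hconst := is_const_of_deriv_eq_zero (fun t => (hd t).differentiableAt)
      fun t => (hd t).deriv
    have hlim : Tendsto (fun t => (P.Ωr' * h t) ^ 2 / 2 + W (ψ t)) atTop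
        (𝓝 ((P.Ωr' * 0) ^ 2 / 2 + W ψsd)) :=
      (((ht2.const_mul P.Ωr').pow 2).div_const 2).add ((hWc.tendsto ψsd).comp ht1)
    intro t
    have h1 : Tendsto (fun s => (P.Ωr' * h s) ^ 2 / 2 + W (ψ s)) atTop
        (𝓝 ((P.Ωr' * h t) ^ 2 / 2 + W (ψ t))) := by
      rw [funext fun s => hconst s t]
      exact tendsto_const_nhds
    have := tendsto_nhds_unique h1 hlim
    rw [this]; ring
  have hWle : W ψsk ≤ W ψsd := by
    have := hcons t₀
    rw [ht₀] at this
    nlinarith [sq_nonneg (P.Ωr' * h t₀)]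
  -- For `Ω'_r < 0` the order of the levels is reversed; `hWle`, from the homoclinic orbit over
  -- `ψsk`, rules out the inconsistent sign cases.
  have he : W ψsk < P.Ωr' * E ∧ P.Ωr' * E < W ψsd := by
    have e1 := hHW0 ψsk
    have e2 := hHW0 ψsd
    obtain ⟨h1, h2⟩ := hE
    rcases le_total (P.pendulumH ψsk 0) (P.pendulumH ψsd 0) with h3 | h3
    · rw [min_eq_left h3] at h1
      rw [max_eq_right h3] at h2
      rcases lt_or_gt_of_ne hΩ with h4 | h4
      · nlinarith
      · constructor <;> nlinarith
    · rw [min_eq_right h3] at h1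
      rw [max_eq_left h3] at h2
      rcases lt_or_gt_of_ne hΩ with h4 | h4
      · constructor <;> nlinarith
      · nlinarith
  have hne : ψsd ≠ ψsk := by
    rintro rfl
    exact lt_irrefl _ (he.1.trans he.2)
  obtain ⟨l, r, hlr, hsd, hWlr, hWl, hWmax⟩ : ∃ l r, ψsk ∈ Set.Ioo l r ∧ (ψsd = l ∨ ψsd = r) ∧
      W l = W r ∧ W l = W ψsd ∧ ∀ c ∈ Set.Icc l r, W c ≤ W l := by
    rcases lt_or_gt_of_ne hne with hlt | hgt
    · obtain ⟨M, hM1, hM2, hM3⟩ := exists_homoclinic_turning_point (W := W)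
        (fun t => (hs t).1) hcons ht1 hb1 ht₀ hlt
      refine ⟨ψsd, M, ⟨hlt, lt_of_le_of_ne hM1 ?_⟩, Or.inl rfl, hM2.symm, rfl, hM3⟩
      intro h
      rw [← h] at hM2
      linarith [he.1, he.2]
    -- A saddle to the right of the center is treated by reflecting the line.
    · obtain ⟨M, hM1, hM2, hM3⟩ := exists_homoclinic_turning_point (W := fun x => W (-x))
        (x := fun t => -ψ t) (v := fun t => -(P.Ωr' * h t)) (p := -ψsd) (q := -ψsk)
        (fun t => (hs t).1.fun_neg) (fun t => by simpa using hcons t) ht1.neg hb1.neg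
        (by rw [ht₀]) (neg_lt_neg hgt)
      simp only [neg_neg] at hM2 hM3
      refine ⟨-M, ψsd, ⟨lt_of_le_of_ne (by linarith) ?_, hgt⟩, Or.inr rfl, hM2, hM2, ?_⟩
      · intro h
        rw [h] at hM2
        linarith [he.1, he.2]
      · intro c hc
        have := hM3 (-c) ⟨by linarith [hc.2], by linarith [hc.1]⟩
        rw [neg_neg] at this
        rwa [hM2]
  have huniq : ∀ c ∈ Set.Ioo l r, P.Favg c = 0 → c = ψsk := by
    intro c hc hc'
    refine eq_center_of_torque_zero (μ := P.m / P.n) (by positivity) hc₀ hAB (neg_ne_zero.2 hΩ)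
      hpair.saddle_fixed hpair.center_fixed ?_ hsd (hlr.1.trans hlr.2) hlr hWlr hWmax hc hc'
    -- The product of the two type conditions is `Ω'_r²` times the product of the slopes, so the
    -- slopes at saddle and center have opposite signs.
    have h1 := mul_neg_of_pos_of_neg hpair.saddle_type hpair.center_type
    by_contra! h2
    nlinarith [mul_nonneg (mul_self_nonneg P.Ωr') h2]
  obtain ⟨a, b, hla, hask, hskb, hbr, hWa, hWb, hin⟩ := exists_turning_points hWc hlr.1 hlr.2
    (hWl ▸ he.2) he.1 (hWlr ▸ hWl ▸ he.2)
  have hreg : ∀ c ∈ Set.Ioo l r, c ≠ ψsk → -P.Ωr' * P.Favg c ≠ 0 := fun c hc hc' =>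
    mul_ne_zero (neg_ne_zero.2 hΩ) fun h0 => hc' (huniq c hc h0)
  obtain ⟨x, v, T, hx, hv, hxv, hsweep, hT⟩ := exists_periodic_motion (hask.trans hskb) hW
    (continuous_const.mul hF) hWa hWb hin
    (hreg a ⟨hla, hask.trans hlr.2⟩ hask.ne) (hreg b ⟨hlr.1.trans hskb, hbr⟩ hskb.ne')
  refine ⟨x, fun t => v t / P.Ωr', T, ?_, ?_, hsweep ψsk ⟨hask.le, hskb.le⟩, ?_⟩
  · rw [isPendulumSolution_iff hF]
    intro t
    refine ⟨(hx t).congr_deriv (by field_simp), ((hv t).div_const _).congr_deriv (by field_simp)⟩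
  · intro t
    apply mul_left_cancel₀ hΩ
    rw [hHW, mul_div_cancel₀ _ hΩ, hxv]
  · have hset : {S : ℝ | 0 < S ∧ Function.Periodic x S ∧
        Function.Periodic (fun t => v t / P.Ωr') S} =
        {S : ℝ | 0 < S ∧ Function.Periodic x S ∧ Function.Periodic v S} := by
      ext S
      have : Function.Periodic (fun t => v t / P.Ωr') S ↔ Function.Periodic v S :=
        forall_congr' fun t => div_left_inj' hΩ
      simp only [Set.mem_ofPred_eq, this]
    rw [hset]
    exact hT

end DuffingResonance

theorem mainTheorem4 (P : DuffingResonance) (hm : 0 < P.m) (hn : 0 < P.n) (hδ : 0 < P.δ)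
    (hIr : P.Ir ∈ P.region.actions) (hres : (P.m : ℝ) * P.Ωr = P.n * P.ν)
    (ψsd ψsk : ℝ) (hpair : P.IsSaddleCenterPair ψsd ψsk) (E : ℝ)
    (hE : E ∈ Set.Ioo (min (P.pendulumH ψsk 0) (P.pendulumH ψsd 0))
      (max (P.pendulumH ψsk 0) (P.pendulumH ψsd 0))) :
    (∃ (ψ h : ℝ → ℝ) (T : ℝ), P.IsClosedOrbit ψsk E ψ h T) ∧
    ∀ (ψ h : ℝ → ℝ) (T : ℝ), P.IsClosedOrbit ψsk E ψ h T →
      P.B1 ψ h T = 0 ∧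
      P.B2 ψ h T = -P.δ * P.Ωr' * orbitAvg ψ h T (fun _ y => y ^ 2) ∧
      P.Bσ ψ h T = 1 / 2 * P.σ ^ 2 * (P.Ωr' * P.Ir / P.Ωr) ∧
      P.Ξ ψ h T = P.σ ^ 2 * P.Ωr' ^ 2 * P.Ir / P.Ωr * orbitAvg ψ h T (fun _ y => y ^ 2) := by
  obtain ⟨k, hk, hI⟩ := hIr
  exact ⟨DuffingResonance.exists_isClosedOrbit hm hn hδ hk hI.symm hpair hE,
    fun ψ h T ho => ⟨DuffingResonance.B1_eq_zero hm hk hI.symm ho,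
      DuffingResonance.B2_eq hm hk hI.symm ho, DuffingResonance.Bσ_eq hm hn hk hI.symm ho,
      DuffingResonance.Ξ_eq hm hn hk hI.symm⟩⟩
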